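/- Let $A=(a_{ij})_{i,j\in\mathcal I}$ be a generalized Cartan matrix with $\mathcal I$ finite, $(\mathfrak h,\Pi=\{\alpha_i\}_{i\in\mathcal I},\Pi^\vee=\{\alpha_i^\vee\}_{i\in\mathcal I})$ a (minimal) realization of $A$ over $\mathbb C$, and $\mathfrak g=\mathfrak g(A)$ the corresponding Kac–Moody algebra: the Lie algebra generated by $\mathfrak h$ and $e_i,f_i$ $(i\in\mathcal I)$ with the Chevalley and Serre relations, modulo the largest ideal which intersects $\mathfrak h$ trivially. Let $\Delta\subset\mathfrak h^*$ be its root system and $\Delta^+=\Delta\cap\mathbb Z_{\ge0}\Pi$. For $i\in\mathcal I$ let $s_i(\mu)=\mu-\langle\mu,\alpha_i^\vee\rangle\alpha_i$ be the simple reflection of $\mathfrak h^*$. For $J\subseteq\mathcal I$ put $J^c=\mathcal I\setminus J$, $\Pi_J=\{\alpha_j : j\in J\}$, $\Delta_J^+=\Delta^+\cap\mathbb Z\Pi_J$, and let $W_J$ be the group generated by the $s_j$, $j\in J$. For $S\subseteq\mathfrak h^*$ let $\mathbb R_{\ge0}S$ denote the set of all finite linear combinations of elements of $S$ with coefficients in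 $\mathbb R_{\geq 0}$, with $\mathbb R_{\ge0}\emptyset=\{0\}$. An extremal ray at $x$ of a convex subset $C$ of a real vector space is a ray $\rho=x+\mathbb R_{\ge0}y$ with $y\ne0$ and $\rho\subseteq C$ such that, whenever a point of $\rho$ is written as a finite convex combination $\sum_k d_kx_k$ of points $x_k\in C$, one has $x_k\in\rho$ for all $k$ with $d_k>0$. An extremal ray of $C$ is an extremal ray of $C$ at some point $x\in C$. Proposition 2.11. Let $\lambda\in\mathfrak h^*$ and let $J\subseteq J'_\lambda:=\{i\in\mathcal I : \langle\lambda,\alpha_i^\vee\rangle\in\mathbb R_{\ge0}\}$. Put $J_0:=\{j\in J : s_j(\lambda)=\lambda\}$ and $$\mathcal P(\lambda,J):=\operatorname{conv}_{\mathbb R}(W_J\lambda)-\mathbb R_{\ge0}(\Delta^+\setminus\Delta_J^+)\subseteq\mathfrak h^*$$ (a Minkowski difference). Then $\mathcal P(\lambda,J)$ is a $W_J$-invariant convex subset of $\lambda-\mathbb R_{\ge0}\Pi$. The set of its extremal rays is $$\bigsqcup_{i\in J^c}W_J(\lambda-\mathbb R_{\ge0}\alpha_i)=\bigsqcup_{i\in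 J^c}\{w(\lambda-\mathbb R_{\ge0}\alpha_i) : w\in W_J\},$$ and the set of its extremal rays at $\lambda$ is $\bigsqcup_{i\in J^c}W_{J_0}(\lambda-\mathbb R_{\ge0}\alpha_i)$. The unions are unions of sets of rays, and the orbits for distinct $i$ are disjoint. -/

import Mathlib

open scoped Pointwise

namespace KacMoody

universe u v

/-- A generalized Cartan matrix indexed by `ι`. -/
structure GenCartanMatrix (ι : Type u) where
  a : Matrix ι ι ℤ
  diag : ∀ i, a i i = 2
  off_diag : ∀ i j, i ≠ j → a i j ≤ 0
  symm_zero : ∀ i j, a i j = 0 → a j i = 0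

/-- A (minimal) realization `(𝔥, Π, Π^∨)` of a generalized Cartan matrix `A` over `ℂ`: the simple
roots `root i` in `𝔥^*` are linearly independent, the simple coroots `coroot i` in `𝔥` are linearly
independent, `⟨root j, coroot i⟩ = a i j`, and `dim 𝔥 = 2 |ι| - rank A`. -/
structure Realization {ι : Type u} [Fintype ι] (A : GenCartanMatrix ι)
    (𝔥 : Type v) [AddCommGroup 𝔥] [Module ℂ 𝔥] where
  finite : FiniteDimensional ℂ 𝔥
  root : ι → Module.Dual ℂ 𝔥
  coroot : ι → 𝔥
  root_indep : LinearIndependent ℂ root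
  coroot_indep : LinearIndependent ℂ coroot
  pairing : ∀ i j, root j (coroot i) = (A.a i j : ℂ)
  dim : Module.finrank ℂ 𝔥 + (A.a.map (Int.cast : ℤ → ℂ)).rank = 2 * Fintype.card ι

/-- The generators `e i`, `f i` (`i ∈ ι`) and `h x` (`x ∈ 𝔥`). -/
inductive Gen (ι : Type u) (𝔥 : Type v) : Type (max u v)
  | e : ι → Gen ι 𝔥
  | f : ι → Gen ι 𝔥
  | h : 𝔥 → Gen ι 𝔥

namespace Realization

variable {ι : Type u} [Fintype ι] {A : GenCartanMatrix ι}
  {𝔥 : Type v} [AddCommGroup 𝔥] [Module ℂ 𝔥]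

/-! ### The Kac–Moody algebra -/

section Algebra

/-- The free Lie algebra on the generators. -/
abbrev Free (_ : Realization A 𝔥) : Type (max u v) := FreeLieAlgebra ℂ (Gen ι 𝔥)

/-- The generators in the free Lie algebra. -/
noncomputable def fe (R : Realization A 𝔥) (i : ι) : R.Free := FreeLieAlgebra.of ℂ (Gen.e i)

noncomputable def ff (R : Realization A 𝔥) (i : ι) : R.Free := FreeLieAlgebra.of ℂ (Gen.f i)

noncomputable def fh (R : Realization A 𝔥) (x : 𝔥) : R.Free := FreeLieAlgebra.of ℂ (Gen.h x)

/-- The elements of the free Lie algebra which are set to zero: linearity of `𝔥`, the Chevalley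
relations, and the Serre relations. -/
inductive IsRelator (R : Realization A 𝔥) : R.Free → Prop
  | add (x y : 𝔥) : IsRelator R (R.fh (x + y) - (R.fh x + R.fh y))
  | smul (c : ℂ) (x : 𝔥) : IsRelator R (R.fh (c • x) - c • R.fh x)
  | hh (x y : 𝔥) : IsRelator R ⁅R.fh x, R.fh y⁆
  | he (x : 𝔥) (i : ι) : IsRelator R (⁅R.fh x, R.fe i⁆ - R.root i x • R.fe i)
  | hf (x : 𝔥) (i : ι) : IsRelator R (⁅R.fh x, R.ff i⁆ + R.root i x • R.ff i)
  | ef_same (i : ι) : IsRelator R (⁅R.fe i, R.ff i⁆ - R.fh (R.coroot i))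
  | ef_ne (i j : ι) (hij : i ≠ j) : IsRelator R ⁅R.fe i, R.ff j⁆
  | serre_e (i j : ι) (hij : i ≠ j) :
      IsRelator R ((LieAlgebra.ad ℂ R.Free (R.fe i) ^ (1 - A.a i j).toNat) (R.fe j))
  | serre_f (i j : ι) (hij : i ≠ j) :
      IsRelator R ((LieAlgebra.ad ℂ R.Free (R.ff i) ^ (1 - A.a i j).toNat) (R.ff j))

/-- The ideal of the free Lie algebra generated by the relators. -/
noncomputable def relIdeal (R : Realization A 𝔥) : LieIdeal ℂ R.Free :=
  LieSubmodule.lieSpan ℂ R.Free {x | R.IsRelator x}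

/-- The Lie algebra `\bar 𝔤(A)` with the above presentation. -/
abbrev PreAlgebra (R : Realization A 𝔥) : Type (max u v) := R.Free ⧸ R.relIdeal

/-- The canonical map `𝔥 → \bar 𝔤(A)`. -/
noncomputable def preCartan (R : Realization A 𝔥) (x : 𝔥) : R.PreAlgebra :=
  LieSubmodule.Quotient.mk (R.fh x)

/-- The largest ideal of `\bar 𝔤(A)` which intersects `𝔥` trivially, i.e. the sum of all ideals
which intersect `𝔥` trivially. -/
noncomputable def radIdeal (R : Realization A 𝔥) : LieIdeal ℂ R.PreAlgebra :=
  sSup {I | ∀ x : 𝔥, R.preCartan x ∈ I → R.preCartan x = 0}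

/-- The Kac–Moody algebra `𝔤(A)`. -/
abbrev Algebra (R : Realization A 𝔥) : Type (max u v) := R.PreAlgebra ⧸ R.radIdeal

/-- The canonical map `𝔥 → 𝔤(A)`. -/
noncomputable def cartan (R : Realization A 𝔥) (x : 𝔥) : R.Algebra :=
  LieSubmodule.Quotient.mk (R.preCartan x)

end Algebra

/-! ### Roots -/

/-- The root system `Δ`: the nonzero weights of `𝔥` on `𝔤(A)`. -/
def roots (R : Realization A 𝔥) : Set (Module.Dual ℂ 𝔥) :=
  {β | β ≠ 0 ∧ ∃ x : R.Algebra, x ≠ 0 ∧ ∀ t : 𝔥, ⁅R.cartan t, x⁆ = β t • x}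

/-- The positive roots `Δ^+ = Δ ∩ ℤ_{≥ 0} Π`. -/
def posRoots (R : Realization A 𝔥) : Set (Module.Dual ℂ 𝔥) :=
  R.roots ∩ AddSubmonoid.closure (Set.range R.root)

/-- The roots `Δ_J = Δ ∩ ℤ Π_J`. -/
def subRoots (R : Realization A 𝔥) (J : Set ι) : Set (Module.Dual ℂ 𝔥) :=
  R.roots ∩ AddSubgroup.closure (R.root '' J)

/-- The positive roots `Δ_J^+` of `Δ_J`. -/
def subPosRoots (R : Realization A 𝔥) (J : Set ι) : Set (Module.Dual ℂ 𝔥) :=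
  R.subRoots J ∩ R.posRoots

theorem eval_coroot_root (R : Realization A 𝔥) (i : ι) :
    Module.Dual.eval ℂ 𝔥 (R.coroot i) (R.root i) = 2 := by
  simp [R.pairing, A.diag]

/-- The simple reflection `s_i μ = μ - ⟨μ, coroot i⟩ root i` of `𝔥^*`. -/
noncomputable def simpleReflection (R : Realization A 𝔥) (i : ι) :
    Module.Dual ℂ 𝔥 ≃ₗ[ℂ] Module.Dual ℂ 𝔥 :=
  Module.reflection (R.eval_coroot_root i)

/-- The parabolic subgroup `W_J` of the Weyl group, generated by the `s_j` with `j ∈ J`. -/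
def parabolic (R : Realization A 𝔥) (J : Set ι) :
    Subgroup (Module.Dual ℂ 𝔥 ≃ₗ[ℂ] Module.Dual ℂ 𝔥) :=
  Subgroup.closure (R.simpleReflection '' J)

/-- The set `J'_λ` of the `i` such that `⟨λ, coroot i⟩` is a non-negative real number. -/
def realDominant (R : Realization A 𝔥) (lam : Module.Dual ℂ 𝔥) : Set ι :=
  {i | ∃ r : ℝ, 0 ≤ r ∧ lam (R.coroot i) = (r : ℂ)}

/-- The set `J_0` of the `j ∈ J` such that `s_j λ = λ`. -/
def fixing (R : Realization A 𝔥) (lam : Module.Dual ℂ 𝔥) (J : Set ι) : Set ι :=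
  {j | j ∈ J ∧ R.simpleReflection j lam = lam}

/-- The set `P(λ, J) = conv_ℝ (W_J λ) - ℝ_{≥ 0} (Δ^+ \ Δ_J^+)` (a Minkowski difference). -/
def shape (R : Realization A 𝔥) (lam : Module.Dual ℂ 𝔥) (J : Set ι) : Set (Module.Dual ℂ 𝔥) :=
  convexHull ℝ {μ | ∃ w ∈ R.parabolic J, w lam = μ} -
    (PointedCone.hull ℝ (R.posRoots \ R.subPosRoots J) : Set (Module.Dual ℂ 𝔥))

end Realization

/-! ### Rays -/

section Rays

variable {E : Type*} [AddCommGroup E] [Module ℝ E]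

/-- The ray `x + ℝ_{≥ 0} y`. -/
def ray (x y : E) : Set E := {z | ∃ r : ℝ, 0 ≤ r ∧ z = x + r • y}

/-- `ρ` is an extremal ray of `C` at the point `x`: it is a (nondegenerate) ray at `x` contained in
`C`, and whenever a point of `ρ` is a convex combination of points of `C`, all points which occur
with positive coefficient lie in `ρ`. -/
def IsExtremalRayAt (C : Set E) (x : E) (ρ : Set E) : Prop :=
  ∃ y : E, y ≠ 0 ∧ ρ = ray x y ∧ ρ ⊆ C ∧
    ∀ (r : ℝ) (n : ℕ) (d : Fin n → ℝ) (z : Fin n → E), 0 ≤ r → (∀ k, 0 ≤ d k) →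
      ∑ k, d k = 1 → (∀ k, z k ∈ C) → x + r • y = ∑ k, d k • z k →
      ∀ k, 0 < d k → z k ∈ ρ

/-- The set of extremal rays of `C` at the point `x`. -/
def extremalRaysAt (C : Set E) (x : E) : Set (Set E) := {ρ | IsExtremalRayAt C x ρ}

/-- The set of all extremal rays of `C`. -/
def extremalRays (C : Set E) : Set (Set E) := {ρ | ∃ x ∈ C, IsExtremalRayAt C x ρ}

end Rays

/-- The set `G · ρ` of the images of the subset `ρ` of `𝔥^*` under the elements of the group `G`. -/
def orbitOfSet {V : Type*} [AddCommGroup V] [Module ℂ V] (G : Subgroup (V ≃ₗ[ℂ] V)) (ρ : Set V) :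
    Set (Set V) :=
  {σ | ∃ w ∈ G, σ = w '' ρ}

end KacMoody

/-! Write `P` for the shape. Two facts about roots carry the proof. (1) If `lam` is `J`-dominant,
then `lam - w lam` lies in the real cone of the simple roots for all `w ∈ W_J` (`sub_mem_rootCone`).
(2) The cone spanned by `Δ⁺ \ Δ_J⁺` is already spanned by `W_J Π_{Jᶜ}` (`hull_posRoots_diff`).

By (1) and (2), `P ⊆ lam - ℝ≥0 Π`. Since `Π` is linearly independent, `lam` is a vertex of `P`, and
so is each `w lam` by `W_J`-invariance; the edges `lam - ℝ≥0 α_i` of the simplicial cone which lie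
in `P` (those with `i ∉ J`) are extremal. Conversely, an extremal ray contains some `w lam - κ`
other than its origin. It then contains `w lam`, which must be the origin, and splitting one
generator off `κ` shows that the direction is `-β` with `β ∈ W_J Π_{Jᶜ}`
(`exists_eq_ray_of_isExtremalRayAt`). For rays at `lam`, induction on the height of `β` puts `β` in
`W_{J₀} α_i` (`exists_eq_of_isExtremalRayAt`): a reflection that lowers `β` but moves `lam` would
exhibit a point of the ray as the midpoint of a segment leaving it. Orbits for distinct `i` are
disjoint because `W_J` preserves coefficients at indices outside `J`.

The root facts come from the algebra itself. Representations on words show that `𝔥` embeds in the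
Kac–Moody algebra, so simple roots are roots; the Serre relations make the generators act locally
nilpotently, so `sl₂`-strings give reflection invariance; spanning by iterated brackets gives the
sign dichotomy and a lowering lemma used for (2). For (1), a dominant integral form is modelled by
minus a new simple root of an enlarged Cartan matrix, and positivity of roots there gives the claim;
the real case follows by linearity. -/

namespace KacMoody

universe u v

/-! ### Lie algebras with Chevalley generators -/

/-- Elements of a Lie algebra `G` which satisfy the Chevalley relations of the realization `R`. -/
structure ChevalleySystem {ι : Type*} [Fintype ι] {A : GenCartanMatrix ι} {𝔥 : Type*}
    [AddCommGroup 𝔥] [Module ℂ 𝔥] (R : Realization A 𝔥) (G : Type*) [LieRing G]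
    [LieAlgebra ℂ G] where
  e : ι → G
  f : ι → G
  h : 𝔥 →ₗ[ℂ] G
  lie_h_h : ∀ x y, ⁅h x, h y⁆ = 0
  lie_h_e : ∀ x i, ⁅h x, e i⁆ = R.root i x • e i
  lie_h_f : ∀ x i, ⁅h x, f i⁆ = -(R.root i x • f i)
  lie_e_f_same : ∀ i, ⁅e i, f i⁆ = h (R.coroot i)
  lie_e_f_ne : ∀ i j, i ≠ j → ⁅e i, f j⁆ = 0

namespace ChevalleySystem

variable {ι : Type*} [Fintype ι] {A : GenCartanMatrix ι} {𝔥 : Type*}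
  [AddCommGroup 𝔥] [Module ℂ 𝔥] {R : Realization A 𝔥} {G : Type*} [LieRing G]
  [LieAlgebra ℂ G] (C : ChevalleySystem R G)

/-- The Chevalley system obtained by exchanging the `e i` and the `f i`. -/
def swap : ChevalleySystem R G where
  e := C.f
  f := C.e
  h := -C.h
  lie_h_h x y := by simp [C.lie_h_h]
  lie_h_e x i := by simp [C.lie_h_f]
  lie_h_f x i := by simp [C.lie_h_e]
  lie_e_f_same i := by rw [← lie_skew, C.lie_e_f_same]; rfl
  lie_e_f_ne i j hij := by rw [← lie_skew, C.lie_e_f_ne j i hij.symm, neg_zero]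

@[simp] theorem swap_e (i : ι) : C.swap.e i = C.f i := rfl

@[simp] theorem swap_f (i : ι) : C.swap.f i = C.e i := rfl

@[simp] theorem swap_h (x : 𝔥) : C.swap.h x = -C.h x := rfl

theorem swap_swap : C.swap.swap = C := by
  cases C
  simp [swap]

/-- The weight space of weight `β`. -/
def weightSpace (β : Module.Dual ℂ 𝔥) : Submodule ℂ G where
  carrier := {x | ∀ t, ⁅C.h t, x⁆ = β t • x}
  add_mem' hx hy t := by simp [hx t, hy t]
  zero_mem' t := by simp
  smul_mem' c x hx t := by simp [hx t, smul_comm c]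

theorem mem_swap_weightSpace {β : Module.Dual ℂ 𝔥} {x : G} :
    x ∈ C.swap.weightSpace β ↔ x ∈ C.weightSpace (-β) := by
  refine forall_congr' fun t => ?_
  rw [swap_h, neg_lie, neg_eq_iff_eq_neg, LinearMap.neg_apply, neg_smul]

theorem lie_mem_weightSpace {β γ : Module.Dual ℂ 𝔥} {x y : G} (hx : x ∈ C.weightSpace β)
    (hy : y ∈ C.weightSpace γ) : ⁅x, y⁆ ∈ C.weightSpace (β + γ) := by
  intro t
  rw [leibniz_lie, hx t, hy t]
  simp [add_smul]

theorem e_mem_weightSpace (i : ι) : C.e i ∈ C.weightSpace (R.root i) := fun t => C.lie_h_e t i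

theorem f_mem_weightSpace (i : ι) : C.f i ∈ C.weightSpace (-R.root i) := fun t => by
  simp [C.lie_h_f t i]

theorem h_mem_weightSpace (x : 𝔥) : C.h x ∈ C.weightSpace 0 := fun t => by
  simp [C.lie_h_h t x]

/-- A weight is a linear form with nonzero weight space. -/
def IsWeight (β : Module.Dual ℂ 𝔥) : Prop := ∃ x ∈ C.weightSpace β, x ≠ 0

/-- The iterated bracket `[e i₁, [e i₂, …, e iₙ]]`. -/
def mono : List ι → G
  | [] => 0
  | [i] => C.e i
  | i :: j :: l => ⁅C.e i, mono (j :: l)⁆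

theorem mono_mem_weightSpace (l : List ι) : C.mono l ∈ C.weightSpace (l.map R.root).sum := by
  match l with
  | [] => simp [mono]
  | [i] => simpa [mono] using C.e_mem_weightSpace i
  | i :: j :: l =>
    rw [mono, List.map_cons, List.sum_cons]
    exact C.lie_mem_weightSpace (C.e_mem_weightSpace i) (mono_mem_weightSpace (j :: l))

theorem lie_e_mono_mem (i : ι) (l : List ι) : ⁅C.e i, C.mono l⁆ ∈ insert 0 (Set.range C.mono) := by
  match l with
  | [] => simp [mono]
  | j :: l => exact Or.inr ⟨i :: j :: l, rfl⟩

/-- The span of the iterated brackets of the `e i` and of the image of `h`. -/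
def borel : Submodule ℂ G := Submodule.span ℂ (Set.range C.mono ∪ Set.range C.h)

theorem mono_mem_borel (l : List ι) : C.mono l ∈ C.borel := Submodule.subset_span (Or.inl ⟨l, rfl⟩)

theorem e_mem_borel (i : ι) : C.e i ∈ C.borel := C.mono_mem_borel [i]

theorem h_mem_borel (x : 𝔥) : C.h x ∈ C.borel := Submodule.subset_span (Or.inr ⟨x, rfl⟩)

theorem lie_e_mem_borel (i : ι) {x : G} (hx : x ∈ C.borel) : ⁅C.e i, x⁆ ∈ C.borel := by
  induction hx using Submodule.span_induction with
  | mem x hx =>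
    rcases hx with ⟨l, rfl⟩ | ⟨y, rfl⟩
    · rcases C.lie_e_mono_mem i l with h | ⟨l', h⟩
      · rw [h]; exact zero_mem _
      · rw [← h]; exact C.mono_mem_borel l'
    · rw [← lie_skew, C.lie_h_e]
      exact neg_mem (Submodule.smul_mem _ _ (C.e_mem_borel i))
  | zero => simp
  | add x y _ _ hx hy => rw [lie_add]; exact add_mem hx hy
  | smul c x _ hx => rw [lie_smul]; exact Submodule.smul_mem _ _ hx

theorem lie_h_mem_borel (t : 𝔥) {x : G} (hx : x ∈ C.borel) : ⁅C.h t, x⁆ ∈ C.borel := by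
  induction hx using Submodule.span_induction with
  | mem x hx =>
    rcases hx with ⟨l, rfl⟩ | ⟨y, rfl⟩
    · rw [C.mono_mem_weightSpace l t]
      exact Submodule.smul_mem _ _ (C.mono_mem_borel l)
    · rw [C.lie_h_h]; exact zero_mem _
  | zero => simp
  | add x y _ _ hx hy => rw [lie_add]; exact add_mem hx hy
  | smul c x _ hx => rw [lie_smul]; exact Submodule.smul_mem _ _ hx

theorem lie_f_mono_mem_borel (i : ι) (l : List ι) : ⁅C.f i, C.mono l⁆ ∈ C.borel := by
  have hfe (i j : ι) : ⁅C.f i, C.e j⁆ = 0 ∨ ∃ x, ⁅C.f i, C.e j⁆ = C.h x := by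
    by_cases hij : i = j
    · subst hij
      exact Or.inr ⟨-R.coroot i, by rw [← lie_skew, C.lie_e_f_same, map_neg]⟩
    · left
      rw [← lie_skew, C.lie_e_f_ne j i (Ne.symm hij), neg_zero]
  match l with
  | [] => simp [mono]
  | [j] =>
    rcases hfe i j with h | ⟨x, h⟩
    · rw [mono, h]; exact zero_mem _
    · rw [mono, h]; exact C.h_mem_borel x
  | j :: k :: l =>
    rw [mono, leibniz_lie]
    refine add_mem ?_ (C.lie_e_mem_borel j (lie_f_mono_mem_borel i (k :: l)))
    rcases hfe i j with h | ⟨x, h⟩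
    · rw [h, zero_lie]; exact zero_mem _
    · rw [h]; exact C.lie_h_mem_borel x (C.mono_mem_borel _)

theorem lie_f_mem_borel_sup (i : ι) {x : G} (hx : x ∈ C.borel) :
    ⁅C.f i, x⁆ ∈ C.borel ⊔ C.swap.borel := by
  induction hx using Submodule.span_induction with
  | mem x hx =>
    rcases hx with ⟨l, rfl⟩ | ⟨y, rfl⟩
    · exact Submodule.mem_sup_left (C.lie_f_mono_mem_borel i l)
    · refine Submodule.mem_sup_right ?_
      rw [← lie_skew, C.lie_h_f, neg_neg]
      exact Submodule.smul_mem _ _ (C.swap.e_mem_borel i)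
  | zero => simp
  | add x y _ _ hx hy => rw [lie_add]; exact add_mem hx hy
  | smul c x _ hx => rw [lie_smul]; exact Submodule.smul_mem _ _ hx

/-- The Chevalley generators generate the Lie algebra. -/
def Generates : Prop := ∀ S : LieSubalgebra ℂ G, (∀ i, C.e i ∈ S) → (∀ i, C.f i ∈ S) →
  (∀ x, C.h x ∈ S) → S = ⊤

variable {C}

theorem Generates.swap (hC : C.Generates) : C.swap.Generates := fun S he hf hh =>
  hC S hf he fun x => by simpa using hh x

theorem Generates.borel_sup_borel (hC : C.Generates) : C.borel ⊔ C.swap.borel = ⊤ := by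
  set T := C.borel ⊔ C.swap.borel with hT
  have stab {x : G} (h₁ : ∀ y ∈ C.borel, ⁅x, y⁆ ∈ T) (h₂ : ∀ y ∈ C.swap.borel, ⁅x, y⁆ ∈ T) :
      ∀ y ∈ T, ⁅x, y⁆ ∈ T := by
    intro y hy
    obtain ⟨y₁, hy₁, y₂, hy₂, rfl⟩ := Submodule.mem_sup.1 hy
    rw [lie_add]
    exact add_mem (h₁ _ hy₁) (h₂ _ hy₂)
  -- The normalizer of `T` is a subalgebra containing the generators, hence everything; so `T` is an
  -- ideal, in particular a subalgebra, and it contains the generators too.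
  let N : LieSubalgebra ℂ G :=
    { carrier := {x | ∀ y ∈ T, ⁅x, y⁆ ∈ T}
      add_mem' := fun ha hb y hy => by rw [add_lie]; exact add_mem (ha y hy) (hb y hy)
      zero_mem' := fun y _ => by simp
      smul_mem' := fun c x hx y hy => by rw [smul_lie]; exact Submodule.smul_mem _ _ (hx y hy)
      lie_mem' := fun ha hb y hy => by
        rw [lie_lie]; exact sub_mem (ha _ (hb y hy)) (hb _ (ha y hy)) }
  have hN : N = ⊤ := by
    refine hC N (fun i => stab ?_ ?_) (fun i => stab ?_ ?_) (fun x => stab ?_ ?_)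
    · exact fun y hy => Submodule.mem_sup_left (C.lie_e_mem_borel i hy)
    · intro y hy
      have := C.swap.lie_f_mem_borel_sup i hy
      rwa [swap_swap, sup_comm] at this
    · exact fun y hy => C.lie_f_mem_borel_sup i hy
    · exact fun y hy => Submodule.mem_sup_right (C.swap.lie_e_mem_borel i hy)
    · exact fun y hy => Submodule.mem_sup_left (C.lie_h_mem_borel x hy)
    · intro y hy
      have := C.swap.lie_h_mem_borel x hy
      rw [swap_h, neg_lie, neg_mem_iff] at this
      exact Submodule.mem_sup_right this
  let S : LieSubalgebra ℂ G :=
    { T with lie_mem' := fun {a b} _ hb => (hN ▸ LieSubalgebra.mem_top a : a ∈ N) b hb }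
  have hS : S = ⊤ := hC S (fun i => Submodule.mem_sup_left (C.e_mem_borel i))
    (fun i => Submodule.mem_sup_right (C.swap.e_mem_borel i))
    (fun x => Submodule.mem_sup_left (C.h_mem_borel x))
  rw [eq_top_iff]
  intro x _
  exact (hS ▸ LieSubalgebra.mem_top x : x ∈ S)

theorem Generates.span_eq_top (hC : C.Generates) :
    Submodule.span ℂ (Set.range C.mono ∪ Set.range C.swap.mono ∪ Set.range C.h) = ⊤ := by
  rw [eq_top_iff, ← hC.borel_sup_borel]
  refine sup_le (Submodule.span_mono ?_) (Submodule.span_le.2 ?_)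
  · rintro x (hx | hx)
    · exact Or.inl (Or.inl hx)
    · exact Or.inr hx
  · rintro x (hx | ⟨y, rfl⟩)
    · exact Submodule.subset_span (Or.inl (Or.inr hx))
    · exact neg_mem (Submodule.subset_span (Or.inr ⟨y, rfl⟩))

variable (C)

/-- The operators `ad (h t)` commute, and weight spaces sit inside their joint generalized
eigenspaces, which are independent. -/
theorem iSupIndep_weightSpace : iSupIndep C.weightSpace := by
  have h := Module.End.independent_iInf_maxGenEigenspace_of_forall_mapsTo
    (fun t : 𝔥 => LieAlgebra.ad ℂ G (C.h t)) (fun s t φ => by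
      refine Module.End.mapsTo_maxGenEigenspace_of_comm ?_ φ
      refine LinearMap.ext fun x => ?_
      simp only [Module.End.mul_apply, LieAlgebra.ad_apply]
      rw [leibniz_lie, C.lie_h_h, zero_lie, zero_add])
  refine (h.comp (f := fun β : Module.Dual ℂ 𝔥 => (β : 𝔥 → ℂ)) DFunLike.coe_injective).mono ?_
  intro β x hx
  simp only [Function.comp, Submodule.mem_iInf]
  intro t
  rw [Module.End.mem_maxGenEigenspace]
  exact ⟨1, by simp [hx t]⟩

/-- If a set of weight vectors spans, then it contains nonzero vectors of all weights. -/
theorem exists_mem_of_isWeight {B : Set G} (hB : Submodule.span ℂ B = ⊤)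
    (hw : ∀ b ∈ B, ∃ γ, b ∈ C.weightSpace γ) {β : Module.Dual ℂ 𝔥} (hβ : C.IsWeight β) :
    ∃ b ∈ B, b ∈ C.weightSpace β ∧ b ≠ 0 := by
  by_contra! hcon
  obtain ⟨x, hx, hx0⟩ := hβ
  have hle : Submodule.span ℂ B ≤ ⨆ γ, ⨆ (_ : γ ≠ β), C.weightSpace γ := by
    rw [Submodule.span_le]
    intro b hb
    obtain ⟨γ, hγ⟩ := hw b hb
    by_cases h : γ = β
    · subst h
      rw [hcon b hb hγ]
      exact zero_mem _
    · exact Submodule.mem_iSup_of_mem γ (Submodule.mem_iSup_of_mem h hγ)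
  exact hx0 (Submodule.disjoint_def.1 (C.iSupIndep_weightSpace β) x hx
    (hle (hB ▸ Submodule.mem_top)))

variable {C}

/-- Every weight is carried by a member of the spanning set of weight vectors; those from `𝔥` only
carry weight zero. -/
theorem Generates.isWeight_cases (hC : C.Generates) {β : Module.Dual ℂ 𝔥} (hβ : C.IsWeight β)
    (h0 : β ≠ 0) : (∃ l, C.mono l ≠ 0 ∧ (l.map R.root).sum = β) ∨
      ∃ l, C.swap.mono l ≠ 0 ∧ (l.map R.root).sum = -β := by
  have key {γ : Module.Dual ℂ 𝔥} {x : G} (hx : x ∈ C.weightSpace γ) (hx' : x ∈ C.weightSpace β)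
      (hx0 : x ≠ 0) : γ = β := by
    ext t
    exact smul_left_injective ℂ hx0 ((hx t).symm.trans (hx' t))
  have hs (l : List ι) : C.swap.mono l ∈ C.weightSpace (-(l.map R.root).sum) :=
    C.mem_swap_weightSpace.1 (C.swap.mono_mem_weightSpace l)
  obtain ⟨b, hb, hbβ, hb0⟩ := C.exists_mem_of_isWeight hC.span_eq_top (by
    rintro b ((⟨l, rfl⟩ | ⟨l, rfl⟩) | ⟨x, rfl⟩)
    · exact ⟨_, C.mono_mem_weightSpace l⟩
    · exact ⟨_, hs l⟩
    · exact ⟨_, C.h_mem_weightSpace x⟩) hβ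
  rcases hb with (⟨l, rfl⟩ | ⟨l, rfl⟩) | ⟨x, rfl⟩
  · exact Or.inl ⟨l, hb0, key (C.mono_mem_weightSpace l) hbβ hb0⟩
  · exact Or.inr ⟨l, hb0, by rw [← key (hs l) hbβ hb0, neg_neg]⟩
  · exact absurd (key (C.h_mem_weightSpace x) hbβ hb0).symm h0

variable (C)

/-- If the bracket of an iterated bracket of the `e j` with a weight vector is nonzero, then some
`e j` raises a weight to the weight of that bracket. -/
theorem exists_isWeight_of_lie_mono_ne_zero (l : List ι) {μ : Module.Dual ℂ 𝔥} {z : G}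
    (hz : z ∈ C.weightSpace μ) (h : ⁅C.mono l, z⁆ ≠ 0) :
    ∃ j ∈ l, C.IsWeight ((l.map R.root).sum + μ - R.root j) := by
  match l with
  | [] => simp [mono] at h
  | [j] =>
    refine ⟨j, by simp, z, by simpa using hz, ?_⟩
    rintro rfl
    simp at h
  | j :: k :: l =>
    rw [mono, lie_lie] at h
    by_cases h₁ : ⁅C.mono (k :: l), z⁆ = 0
    · rw [h₁, lie_zero, zero_sub, neg_ne_zero] at h
      obtain ⟨m, hm, hw⟩ := exists_isWeight_of_lie_mono_ne_zero (k :: l)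
        (C.lie_mem_weightSpace (C.e_mem_weightSpace j) hz) h
      refine ⟨m, List.mem_cons_of_mem _ hm, ?_⟩
      convert hw using 1
      simp only [List.map_cons, List.sum_cons]
      abel
    · refine ⟨j, by simp, _, ?_, h₁⟩
      convert C.lie_mem_weightSpace (C.mono_mem_weightSpace (k :: l)) hz using 2
      simp only [List.map_cons, List.sum_cons]
      abel

/-! ### Strings and reflections -/

theorem lie_h_ad_f_pow {i : ι} {v : G} {μ : ℂ} (hv : ⁅C.h (R.coroot i), v⁆ = μ • v) (n : ℕ) :
    ⁅C.h (R.coroot i), (LieAlgebra.ad ℂ G (C.f i) ^ n) v⁆ =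
      (μ - 2 * n) • (LieAlgebra.ad ℂ G (C.f i) ^ n) v := by
  induction n with
  | zero => simpa using hv
  | succ n ih =>
    rw [pow_succ', Module.End.mul_apply, LieAlgebra.ad_apply, leibniz_lie, ih, C.lie_h_f,
      R.pairing, A.diag, neg_lie, smul_lie, lie_smul, ← neg_smul, ← add_smul]
    congr 1
    push_cast
    ring

/-- The basic `sl₂` computation: `e f^{n+1} v = (n+1)(μ-n) f^n v` if `e v = 0`, `h v = μ v`. -/
theorem lie_e_ad_f_pow_succ {i : ι} {v : G} {μ : ℂ} (hv : ⁅C.h (R.coroot i), v⁆ = μ • v)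
    (he : ⁅C.e i, v⁆ = 0) (n : ℕ) :
    ⁅C.e i, (LieAlgebra.ad ℂ G (C.f i) ^ (n + 1)) v⁆ =
      ((n + 1) * (μ - n)) • (LieAlgebra.ad ℂ G (C.f i) ^ n) v := by
  induction n with
  | zero => simp [leibniz_lie (C.e i), C.lie_e_f_same, he, hv]
  | succ n ih =>
    rw [pow_succ', Module.End.mul_apply, LieAlgebra.ad_apply, leibniz_lie (C.e i),
      C.lie_e_f_same, C.lie_h_ad_f_pow hv, ih, lie_smul, ← LieAlgebra.ad_apply (R := ℂ),
      ← Module.End.mul_apply, ← pow_succ', ← add_smul]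
    congr 1
    push_cast
    ring

theorem ad_f_pow_mem_weightSpace (i : ι) {β : Module.Dual ℂ 𝔥} {x : G}
    (hx : x ∈ C.weightSpace β) (n : ℕ) :
    (LieAlgebra.ad ℂ G (C.f i) ^ n) x ∈ C.weightSpace (β - n • R.root i) := by
  induction n with
  | zero => simpa using hx
  | succ n ih =>
    rw [pow_succ', Module.End.mul_apply, LieAlgebra.ad_apply]
    convert C.lie_mem_weightSpace (C.f_mem_weightSpace i) ih using 2
    rw [succ_nsmul]
    abel

theorem ad_e_pow_mem_weightSpace (i : ι) {β : Module.Dual ℂ 𝔥} {x : G}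
    (hx : x ∈ C.weightSpace β) (n : ℕ) :
    (LieAlgebra.ad ℂ G (C.e i) ^ n) x ∈ C.weightSpace (β + n • R.root i) := by
  rw [← neg_neg β, ← mem_swap_weightSpace] at hx
  have := C.swap.ad_f_pow_mem_weightSpace i hx n
  rw [mem_swap_weightSpace] at this
  rw [neg_sub, sub_neg_eq_add, add_comm] at this
  exact this

/-- If `e i` and `f i` act locally nilpotently, then `⟨β, coroot i⟩` is an integer for all weights
`β`, and `s_i β` is a weight if this integer is nonnegative. -/
theorem exists_int_isWeight_reflection {i : ι}
    (hE : ∀ x : G, ∃ n : ℕ, (LieAlgebra.ad ℂ G (C.e i) ^ n) x = 0)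
    (hF : ∀ x : G, ∃ n : ℕ, (LieAlgebra.ad ℂ G (C.f i) ^ n) x = 0)
    {β : Module.Dual ℂ 𝔥} (hβ : C.IsWeight β) :
    ∃ n : ℤ, β (R.coroot i) = n ∧ (0 ≤ n → C.IsWeight (R.simpleReflection i β)) := by
  obtain ⟨x, hx, hx0⟩ := hβ
  -- The vector `v = e^p x` is the top of the string through `x`, and `f^q v` is its last nonzero
  -- member. The `sl₂` formula at `n = q` then forces `μ = q`.
  obtain ⟨p, hp, hp'⟩ := Nat.exists_not_and_succ_of_not_zero_of_exists
    (p := fun n => (LieAlgebra.ad ℂ G (C.e i) ^ n) x = 0) (by simpa using hx0) (hE x)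
  set v := (LieAlgebra.ad ℂ G (C.e i) ^ p) x with hv
  have hvw := C.ad_e_pow_mem_weightSpace i hx p
  have he : ⁅C.e i, v⁆ = 0 := by
    rw [← hp', pow_succ', Module.End.mul_apply, LieAlgebra.ad_apply]
  set μ : ℂ := (β + p • R.root i) (R.coroot i) with hμ
  have hh : ⁅C.h (R.coroot i), v⁆ = μ • v := hvw _
  obtain ⟨q, hq, hq'⟩ := Nat.exists_not_and_succ_of_not_zero_of_exists
    (p := fun n => (LieAlgebra.ad ℂ G (C.f i) ^ n) v = 0) (by simpa using hp) (hF v)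
  have hμq : μ = q := by
    have := C.lie_e_ad_f_pow_succ hh he q
    rw [hq', lie_zero, eq_comm, smul_eq_zero_iff_left hq, mul_eq_zero, sub_eq_zero] at this
    exact this.resolve_left (Nat.cast_add_one_ne_zero q)
  have hβq : β (R.coroot i) = (q - 2 * p : ℤ) := by
    have : β (R.coroot i) + p * 2 = q := by
      rw [← hμq, hμ]
      simp [R.pairing, A.diag]
    push_cast
    rw [← this]
    ring
  refine ⟨q - 2 * p, hβq, fun hn => ?_⟩
  -- The vector `f^(q-p) v` has weight `s_i β`. Nonnegativity of `q - 2p` makes the natural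
  -- subtraction `q - p` exact.
  have hpq : q - p ≤ q := Nat.sub_le _ _
  refine ⟨_, ?_, fun h0 => hq (Module.End.pow_map_zero_of_le hpq h0)⟩
  convert C.ad_f_pow_mem_weightSpace i hvw (q - p) using 2
  rw [Realization.simpleReflection, Module.reflection_apply, Module.Dual.eval_apply, hβq]
  have : ((q - 2 * p : ℤ) : ℂ) = ((q - p : ℕ) : ℂ) - p := by
    rw [Nat.cast_sub (by omega)]
    push_cast
    ring
  rw [this, sub_smul]
  simp only [Nat.cast_smul_eq_nsmul]
  abel

theorem isWeight_swap {β : Module.Dual ℂ 𝔥} : C.swap.IsWeight β ↔ C.IsWeight (-β) := by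
  simp [IsWeight, mem_swap_weightSpace]

/-- When the pairing is negative, the string argument is applied to `-β` in the swapped system. -/
theorem isWeight_reflection {i : ι}
    (hE : ∀ x : G, ∃ n : ℕ, (LieAlgebra.ad ℂ G (C.e i) ^ n) x = 0)
    (hF : ∀ x : G, ∃ n : ℕ, (LieAlgebra.ad ℂ G (C.f i) ^ n) x = 0)
    {β : Module.Dual ℂ 𝔥} (hβ : C.IsWeight β) : C.IsWeight (R.simpleReflection i β) := by
  obtain ⟨n, hn, h⟩ := C.exists_int_isWeight_reflection hE hF hβ
  obtain ⟨m, hm, h'⟩ := C.swap.exists_int_isWeight_reflection hF hE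
    (β := -β) (by rwa [isWeight_swap, neg_neg])
  rcases le_total 0 n with h0 | h0
  · exact h h0
  · have hmn : m = -n := by
      have : (m : ℂ) = (-n : ℤ) := by rw [← hm]; simp [hn]
      exact_mod_cast this
    have := h' (by omega)
    rwa [isWeight_swap, map_neg, neg_neg] at this

/-! ### The Serre elements -/

theorem lie_e_ad_f_pow {i k : ι} (hki : k ≠ i) (n : ℕ) (x : G) :
    ⁅C.e k, (LieAlgebra.ad ℂ G (C.f i) ^ n) x⁆ = (LieAlgebra.ad ℂ G (C.f i) ^ n) ⁅C.e k, x⁆ := by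
  induction n with
  | zero => simp
  | succ n ih =>
    rw [pow_succ', Module.End.mul_apply, LieAlgebra.ad_apply, leibniz_lie, C.lie_e_f_ne k i hki,
      zero_lie, zero_add, ih]
    rfl

/-- The `e k` commute with the Serre elements in the `f i`. -/
theorem lie_e_serre_f {i j : ι} (hij : i ≠ j) (k : ι) :
    ⁅C.e k, (LieAlgebra.ad ℂ G (C.f i) ^ (1 - A.a i j).toNat) (C.f j)⁆ = 0 := by
  have ha := A.off_diag i j hij
  obtain ⟨n, hn⟩ : ∃ n : ℕ, A.a i j = -n := ⟨(-A.a i j).toNat, by omega⟩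
  have hn' : (1 - A.a i j).toNat = n + 1 := by omega
  rw [hn']
  by_cases hki : k = i
  · subst hki
    rw [C.lie_e_ad_f_pow_succ (μ := n) _ (C.lie_e_f_ne k j hij)]
    · simp
    · rw [C.lie_h_f, R.pairing, hn]
      simp
  · rw [C.lie_e_ad_f_pow hki]
    by_cases hkj : k = j
    · subst hkj
      rw [C.lie_e_f_same, pow_succ, Module.End.mul_apply, LieAlgebra.ad_apply, ← lie_skew,
        C.lie_h_f, neg_neg, R.pairing, map_smul]
      -- What remains is a multiple of `ad(f i)^n (f i)`. It vanishes for `n > 0`; for `n = 0` the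
      -- scalar vanishes, by the symmetry of the zero entries of the Cartan matrix.
      rcases Nat.eq_zero_or_pos n with h0 | h0
      · rw [A.symm_zero i k (by simp [hn, h0])]
        simp
      · obtain ⟨m, rfl⟩ := Nat.exists_eq_succ_of_ne_zero h0.ne'
        rw [pow_succ, Module.End.mul_apply, LieAlgebra.ad_apply, lie_self, map_zero, smul_zero]
    · rw [C.lie_e_f_ne k j hkj, map_zero]

/-- The `f k` commute with the Serre elements in the `e i`. -/
theorem lie_f_serre_e {i j : ι} (hij : i ≠ j) (k : ι) :
    ⁅C.f k, (LieAlgebra.ad ℂ G (C.e i) ^ (1 - A.a i j).toNat) (C.e j)⁆ = 0 :=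
  C.swap.lie_e_serre_f hij k

end ChevalleySystem

theorem map_ad_pow {G₁ G₂ : Type*} [LieRing G₁] [LieAlgebra ℂ G₁] [LieRing G₂] [LieAlgebra ℂ G₂]
    (F : G₁ →ₗ⁅ℂ⁆ G₂) (a b : G₁) (n : ℕ) :
    F ((LieAlgebra.ad ℂ G₁ a ^ n) b) = (LieAlgebra.ad ℂ G₂ (F a) ^ n) (F b) := by
  induction n with
  | zero => simp
  | succ n ih =>
    rw [pow_succ', pow_succ', Module.End.mul_apply, Module.End.mul_apply, ← ih,
      LieAlgebra.ad_apply, LieAlgebra.ad_apply, LieHom.map_lie]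

theorem freeLieAlgebra_eq_top {X : Type*} (S : LieSubalgebra ℂ (FreeLieAlgebra ℂ X))
    (h : ∀ x, FreeLieAlgebra.of ℂ x ∈ S) : S = ⊤ := by
  let φ : FreeLieAlgebra ℂ X →ₗ⁅ℂ⁆ S :=
    FreeLieAlgebra.lift ℂ fun x => (⟨FreeLieAlgebra.of ℂ x, h x⟩ : S)
  have hφ : S.incl.comp φ = LieHom.id := FreeLieAlgebra.hom_ext fun x => by
    rw [LieHom.comp_apply, FreeLieAlgebra.lift_of_apply]
    rfl
  rw [eq_top_iff]
  intro y _
  have := congrArg (fun ψ => ψ y) hφ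
  simp only [LieHom.comp_apply, LieHom.id_apply] at this
  rw [← this]
  exact (φ y).2

/-! ### Verma modules -/

namespace Verma

attribute [local instance] LieRing.ofAssociativeRing

variable {ι : Type*} [Fintype ι] {A : GenCartanMatrix ι} {𝔥 : Type*}
  [AddCommGroup 𝔥] [Module ℂ 𝔥] (R : Realization A 𝔥) (lam : Module.Dual ℂ 𝔥)

/-- The action of `f i` on words. -/
noncomputable def F (i : ι) : Module.End ℂ (List ι →₀ ℂ) := Finsupp.lmapDomain ℂ ℂ (List.cons i)

/-- The action of `x ∈ 𝔥` on words. -/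
noncomputable def H : 𝔥 →ₗ[ℂ] Module.End ℂ (List ι →₀ ℂ) where
  toFun x := Finsupp.linearCombination ℂ fun l =>
    Finsupp.single l ((lam - (l.map R.root).sum) x)
  map_add' x y := by
    ext l : 2
    simp only [LinearMap.comp_apply, Finsupp.lsingle_apply, LinearMap.add_apply,
      Finsupp.linearCombination_single, one_smul, map_add, Finsupp.single_add]
  map_smul' c x := by
    ext l : 2
    simp only [LinearMap.comp_apply, Finsupp.lsingle_apply, LinearMap.smul_apply,
      Finsupp.linearCombination_single, one_smul, map_smul, RingHom.id_apply,
      Finsupp.smul_single]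

open Classical in
/-- The image of a basis vector under the action of `e i`. -/
noncomputable def EWord (i : ι) : List ι → (List ι →₀ ℂ)
  | [] => 0
  -- This recursion is forced by `e_i f_j = f_j e_i + δ_ij h(coroot i)`, with `h` acting on the word
  -- `l` through its weight.
  | j :: l => (if i = j then
      Finsupp.single l ((lam - (l.map R.root).sum) (R.coroot i)) else 0) + F j (EWord i l)

/-- The action of `e i` on words. -/
noncomputable def E (i : ι) : Module.End ℂ (List ι →₀ ℂ) :=
  Finsupp.linearCombination ℂ (EWord R lam i)

omit [Fintype ι] in
theorem F_single (i : ι) (l : List ι) (c : ℂ) :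
    F i (Finsupp.single l c) = Finsupp.single (i :: l) c := by
  simp [F]

theorem H_single (x : 𝔥) (l : List ι) (c : ℂ) :
    H R lam x (Finsupp.single l c) = (lam - (l.map R.root).sum) x • Finsupp.single l c := by
  change Finsupp.linearCombination ℂ _ _ = _
  rw [Finsupp.linearCombination_single, Finsupp.smul_single, Finsupp.smul_single, smul_eq_mul,
    smul_eq_mul, mul_comm]

theorem E_nil (i : ι) (c : ℂ) : E R lam i (Finsupp.single [] c) = 0 := by
  simp [E, EWord]

omit [Fintype ι] in
theorem end_ext {S T : Module.End ℂ (List ι →₀ ℂ)}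
    (h : ∀ l, S (Finsupp.single l 1) = T (Finsupp.single l 1)) : S = T := by
  ext l : 2
  exact h l

omit [Fintype ι] in
theorem lie_def (S T : Module.End ℂ (List ι →₀ ℂ)) : ⁅S, T⁆ = S * T - T * S := rfl

theorem lie_H_H (x y : 𝔥) : ⁅H R lam x, H R lam y⁆ = 0 := by
  refine end_ext fun l => ?_
  rw [lie_def, LinearMap.sub_apply, Module.End.mul_apply, Module.End.mul_apply, H_single,
    H_single, map_smul, map_smul, H_single, H_single, smul_comm, sub_self, LinearMap.zero_apply]

theorem lie_H_F (x : 𝔥) (i : ι) :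
    ⁅H R lam x, (F i : Module.End ℂ (List ι →₀ ℂ))⁆ = -(R.root i x • F i) := by
  refine end_ext fun l => ?_
  simp only [lie_def, LinearMap.sub_apply, Module.End.mul_apply, H_single, F_single,
    map_smul, LinearMap.neg_apply, LinearMap.smul_apply, ← sub_smul, ← neg_smul]
  congr 1
  simp

theorem E_F_same (i : ι) : E R lam i * F i = F i * E R lam i + H R lam (R.coroot i) := by
  refine end_ext fun l => ?_
  simp [F_single, E, EWord, H_single, add_comm]

theorem E_F_ne {i j : ι} (hij : i ≠ j) : E R lam i * F j = F j * E R lam i := by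
  refine end_ext fun l => ?_
  simp [F_single, E, EWord, hij]

theorem lie_H_E (x : 𝔥) (i : ι) : ⁅H R lam x, E R lam i⁆ = R.root i x • E R lam i := by
  refine end_ext fun l => ?_
  induction l with
  | nil => simp [lie_def, E_nil, H_single]
  | cons j l ih =>
    have hHF' (v : List ι →₀ ℂ) :
        H R lam x (F j v) = F j (H R lam x v) - R.root j x • F j v := by
      have := congrArg (fun T => T v) (lie_H_F R lam x j)
      change H R lam x (F j v) - F j (H R lam x v) = -(R.root j x • F j v) at this
      rw [eq_add_of_sub_eq this]
      abel
    have hjl : Finsupp.single (j :: l) (1 : ℂ) = F j (Finsupp.single l 1) := (F_single _ _ _).symm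
    rw [lie_def] at ih ⊢
    simp only [LinearMap.sub_apply, Module.End.mul_apply, LinearMap.smul_apply] at ih ⊢
    rw [hjl]
    by_cases hij : i = j
    · subst hij
      have hEF (v : List ι →₀ ℂ) : E R lam i (F i v) =
          F i (E R lam i v) + H R lam (R.coroot i) v := congrArg (fun T => T v) (E_F_same R lam i)
      have hHH := congrArg (fun T => T (Finsupp.single l 1)) (lie_H_H R lam x (R.coroot i))
      simp only [lie_def, LinearMap.sub_apply, Module.End.mul_apply,
        LinearMap.zero_apply, sub_eq_zero] at hHH
      rw [hEF, map_add, hHF', hHF', map_sub, map_smul, hEF, hEF, hHH]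
      have := congrArg (F i) ih
      rw [map_sub, map_smul, sub_eq_iff_eq_add] at this
      rw [this]
      module
    · have hEF (v : List ι →₀ ℂ) : E R lam i (F j v) =
          F j (E R lam i v) := congrArg (fun T => T v) (E_F_ne R lam hij)
      rw [hEF, hHF', hHF', map_sub, map_smul, hEF, hEF]
      have := congrArg (F j) ih
      rw [map_sub, map_smul, sub_eq_iff_eq_add] at this
      rw [this]
      module

/-- The operators on words form a Chevalley system. -/
noncomputable def system : ChevalleySystem R (Module.End ℂ (List ι →₀ ℂ)) where
  e := E R lam
  f := F
  h := H R lam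
  lie_h_h := lie_H_H R lam
  lie_h_e := lie_H_E R lam
  lie_h_f := lie_H_F R lam
  lie_e_f_same i := by rw [lie_def, E_F_same]; abel
  lie_e_f_ne i j hij := by rw [lie_def, E_F_ne R lam hij]; exact sub_self (F j * E R lam i)

/-- The composition of the operators `E i`. -/
noncomputable def act : List ι → Module.End ℂ (List ι →₀ ℂ)
  | [] => 1
  | i :: l => act l * E R lam i

/-- The maximal proper submodule of the Verma module. -/
noncomputable def maxSubmodule : Submodule ℂ (List ι →₀ ℂ) where
  -- These are the vectors from which no product of operators `E i` reaches the highest weight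
  -- vector `[]`.
  carrier := {v | ∀ l, act R lam l v [] = 0}
  add_mem' hx hy l := by simp [hx l, hy l]
  zero_mem' l := by simp
  smul_mem' c x hx l := by simp [hx l]

theorem H_apply_nil (x : 𝔥) (v : List ι →₀ ℂ) : H R lam x v [] = lam x * v [] := by
  induction v using Finsupp.induction_linear with
  | zero => simp
  | add v w hv hw => simp only [map_add, Finsupp.add_apply, hv, hw, mul_add]
  | single l c =>
    rw [H_single]
    rcases l with _ | ⟨i, l⟩ <;> simp

omit [Fintype ι] in
theorem F_apply_nil (i : ι) (v : List ι →₀ ℂ) : F i v [] = 0 := by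
  induction v using Finsupp.induction_linear with
  | zero => simp
  | add v w hv hw => simp only [map_add, Finsupp.add_apply, hv, hw, add_zero]
  | single l c => rw [F_single]; simp

theorem E_mem {v : List ι →₀ ℂ} (hv : v ∈ maxSubmodule R lam) (i : ι) :
    E R lam i v ∈ maxSubmodule R lam := fun l => hv (i :: l)

theorem H_mem {v : List ι →₀ ℂ} (hv : v ∈ maxSubmodule R lam) (x : 𝔥) :
    H R lam x v ∈ maxSubmodule R lam := by
  intro l
  induction l generalizing v with
  | nil =>
    have := hv []
    rw [act, Module.End.one_apply] at this ⊢
    rw [H_apply_nil, this, mul_zero]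
  | cons i l ih =>
    have hE : E R lam i (H R lam x v) = H R lam x (E R lam i v) - R.root i x • E R lam i v := by
      have := congrArg (fun T => T v) (lie_H_E R lam x i)
      simp only [lie_def, LinearMap.sub_apply, Module.End.mul_apply,
        LinearMap.smul_apply] at this
      rw [← this]
      abel
    rw [act, Module.End.mul_apply, hE, map_sub, Finsupp.sub_apply, ih (E_mem R lam hv i), map_smul,
      Finsupp.smul_apply, E_mem R lam hv i l, smul_zero, sub_zero]

theorem F_mem {v : List ι →₀ ℂ} (hv : v ∈ maxSubmodule R lam) (j : ι) :
    F j v ∈ maxSubmodule R lam := by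
  intro l
  induction l generalizing v with
  | nil => rw [act, Module.End.one_apply, F_apply_nil]
  | cons i l ih =>
    rw [act, Module.End.mul_apply]
    by_cases hij : i = j
    · subst hij
      rw [show E R lam i (F i v) = F i (E R lam i v) + H R lam (R.coroot i) v from
        congrArg (fun T => T v) (E_F_same R lam i), map_add, Finsupp.add_apply,
        ih (E_mem R lam hv i), H_mem R lam hv (R.coroot i) l, add_zero]
    · rw [show E R lam i (F j v) = F j (E R lam i v) from
        congrArg (fun T => T v) (E_F_ne R lam hij), ih (E_mem R lam hv i)]

/-- The Serre operator kills the empty word and commutes with every `F k`, and the `F k` build all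
words from the empty one. -/
theorem serre_e_eq_zero {i j : ι} (hij : i ≠ j) :
    (LieAlgebra.ad ℂ (Module.End ℂ (List ι →₀ ℂ)) (E R lam i) ^ (1 - A.a i j).toNat)
      (E R lam j) = 0 := by
  set S := (LieAlgebra.ad ℂ (Module.End ℂ (List ι →₀ ℂ)) (E R lam i) ^ (1 - A.a i j).toNat)
      (E R lam j) with hS
  refine end_ext fun l => ?_
  induction l with
  | nil =>
    have (n : ℕ) : (LieAlgebra.ad ℂ (Module.End ℂ (List ι →₀ ℂ)) (E R lam i) ^ n)
      (E R lam j) (Finsupp.single [] 1) = 0 := by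
      induction n with
      | zero => simp [E_nil]
      | succ n ih =>
        rw [pow_succ', Module.End.mul_apply, LieAlgebra.ad_apply, lie_def,
          LinearMap.sub_apply, Module.End.mul_apply, Module.End.mul_apply, ih, E_nil]
        simp
    exact this _
  | cons k l ih =>
    have := (system R lam).lie_f_serre_e hij k
    have := congrArg (fun T => T (Finsupp.single l 1)) this
    change F k (S (Finsupp.single l 1)) - S (F k (Finsupp.single l 1)) = 0 at this
    rw [← F_single, ← sub_eq_zero.1 this, ih]
    simp

/-- On the free module of words this operator need not vanish. Its values have no component at `[]`,
and it commutes with every `E k`, so it vanishes on the irreducible quotient. -/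
theorem serre_f_mem {i j : ι} (hij : i ≠ j) (v : List ι →₀ ℂ) :
    (LieAlgebra.ad ℂ (Module.End ℂ (List ι →₀ ℂ)) (F i) ^ (1 - A.a i j).toNat) (F j) v ∈
      maxSubmodule R lam := by
  have hnil (n : ℕ) (v : List ι →₀ ℂ) :
      (LieAlgebra.ad ℂ (Module.End ℂ (List ι →₀ ℂ)) (F i) ^ n) (F j) v [] = 0 := by
    induction n generalizing v with
    | zero => simpa using F_apply_nil j v
    | succ n ih =>
      rw [pow_succ', Module.End.mul_apply, LieAlgebra.ad_apply, lie_def,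
        LinearMap.sub_apply, Module.End.mul_apply, Module.End.mul_apply, Finsupp.sub_apply, ih,
        F_apply_nil, sub_zero]
  intro l
  induction l generalizing v with
  | nil => exact hnil _ v
  | cons k l ih =>
    have := (system R lam).lie_e_serre_f hij k
    have := congrArg (fun T => T v) this
    change E R lam k _ - (LieAlgebra.ad ℂ (Module.End ℂ (List ι →₀ ℂ)) (F i) ^
      (1 - A.a i j).toNat) (F j) (E R lam k v) = 0 at this
    rw [act, Module.End.mul_apply]
    exact (congrArg (fun w => act R lam l w []) (sub_eq_zero.1 this)).trans (ih (E R lam k v))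

/-- The representation of the free Lie algebra on the Verma module. -/
noncomputable def rep : R.Free →ₗ⁅ℂ⁆ Module.End ℂ (List ι →₀ ℂ) :=
  FreeLieAlgebra.lift ℂ fun g => match g with
    | Gen.e i => E R lam i
    | Gen.f i => F i
    | Gen.h x => H R lam x

@[simp] theorem rep_fe (i : ι) : rep R lam (R.fe i) = E R lam i :=
  FreeLieAlgebra.lift_of_apply ..

@[simp] theorem rep_ff (i : ι) : rep R lam (R.ff i) = F i :=
  FreeLieAlgebra.lift_of_apply ..

@[simp] theorem rep_fh (x : 𝔥) : rep R lam (R.fh x) = H R lam x :=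
  FreeLieAlgebra.lift_of_apply ..

theorem rep_mem (x : R.Free) {v : List ι →₀ ℂ} (hv : v ∈ maxSubmodule R lam) :
    rep R lam x v ∈ maxSubmodule R lam := by
  let S : LieSubalgebra ℂ R.Free :=
    { carrier := {x | ∀ v ∈ maxSubmodule R lam, rep R lam x v ∈ maxSubmodule R lam}
      add_mem' := fun ha hb v hv => by
        rw [map_add, LinearMap.add_apply]; exact add_mem (ha v hv) (hb v hv)
      zero_mem' := fun v _ => by simp
      smul_mem' := fun c x hx v hv => by
        rw [map_smul, LinearMap.smul_apply]; exact Submodule.smul_mem _ _ (hx v hv)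
      lie_mem' := fun ha hb v hv => by
        rw [LieHom.map_lie, lie_def, LinearMap.sub_apply]
        exact sub_mem (ha _ (hb v hv)) (hb _ (ha v hv)) }
  have hS : S = ⊤ := by
    refine freeLieAlgebra_eq_top S fun g => ?_
    rcases g with i | i | x
    · exact fun v hv => by
        change rep R lam (R.fe i) v ∈ _
        rw [rep_fe]; exact E_mem R lam hv i
    · exact fun v hv => by
        change rep R lam (R.ff i) v ∈ _
        rw [rep_ff]; exact F_mem R lam hv i
    · exact fun v hv => by
        change rep R lam (R.fh x) v ∈ _
        rw [rep_fh]; exact H_mem R lam hv x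
  exact (hS ▸ LieSubalgebra.mem_top x : x ∈ S) v hv

/-- The ideal of the elements which annihilate the irreducible quotient. -/
noncomputable def annihilator : LieIdeal ℂ R.Free where
  carrier := {x | ∀ v, rep R lam x v ∈ maxSubmodule R lam}
  add_mem' ha hb v := by
    rw [map_add, LinearMap.add_apply]; exact add_mem (ha v) (hb v)
  zero_mem' v := by simp
  smul_mem' c x hx v := by
    rw [map_smul, LinearMap.smul_apply]; exact Submodule.smul_mem _ _ (hx v)
  lie_mem {x y} hy v := by
    rw [LieHom.map_lie, lie_def, LinearMap.sub_apply]
    exact sub_mem (rep_mem R lam x (hy v)) (hy _)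

theorem mem_annihilator_of_eq_zero {x : R.Free} (h : rep R lam x = 0) :
    x ∈ annihilator R lam := fun v => by
  rw [h]; exact zero_mem _

theorem relIdeal_le_annihilator : R.relIdeal ≤ annihilator R lam := by
  rw [Realization.relIdeal, LieSubmodule.lieSpan_le]
  rintro x hx
  cases hx with
  | add x y => exact mem_annihilator_of_eq_zero R lam (by simp)
  | smul c x => exact mem_annihilator_of_eq_zero R lam (by simp)
  | hh x y => exact mem_annihilator_of_eq_zero R lam (by simpa using lie_H_H R lam x y)
  | he x i =>
    exact mem_annihilator_of_eq_zero R lam (by simp [lie_H_E])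
  | hf x i =>
    exact mem_annihilator_of_eq_zero R lam (by
      rw [map_add, LieHom.map_lie, rep_fh, map_smul, rep_ff, lie_H_F]
      exact neg_add_cancel (R.root i x • (F i : Module.End ℂ (List ι →₀ ℂ))))
  | ef_same i =>
    refine mem_annihilator_of_eq_zero R lam ?_
    rw [map_sub, LieHom.map_lie, rep_fe, rep_ff, rep_fh]
    exact sub_eq_zero.2 ((system R lam).lie_e_f_same i)
  | ef_ne i j hij =>
    refine mem_annihilator_of_eq_zero R lam ?_
    rw [LieHom.map_lie, rep_fe, rep_ff]
    exact (system R lam).lie_e_f_ne i j hij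
  | serre_e i j hij =>
    refine mem_annihilator_of_eq_zero R lam ?_
    rw [map_ad_pow, rep_fe, rep_fe, serre_e_eq_zero R lam hij]
  | serre_f i j hij =>
    intro v
    rw [map_ad_pow, rep_ff, rep_ff]
    exact serre_f_mem R lam hij v

end Verma

/-! ### Embedding of the Cartan subalgebra, quotient maps and root coordinates -/

theorem Realization.eq_zero_of_preCartan_eq_zero {ι : Type*} [Fintype ι] {A : GenCartanMatrix ι}
    {𝔥 : Type*} [AddCommGroup 𝔥] [Module ℂ 𝔥] (R : Realization A 𝔥) {x : 𝔥}
    (hx : R.preCartan x = 0) : x = 0 := by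
  rw [Realization.preCartan, LieSubmodule.Quotient.mk_eq_zero'] at hx
  refine (Module.forall_dual_apply_eq_zero_iff ℂ x).1 fun lam => ?_
  -- On the highest weight vector `x` acts by `lam x`, and `lam` is arbitrary.
  have := Verma.relIdeal_le_annihilator R lam hx (Finsupp.single [] 1) []
  rw [Verma.act, Module.End.one_apply, Verma.rep_fh, Verma.H_apply_nil] at this
  simpa using this

/-- The quotient map by an ideal, as a morphism of Lie algebras. -/
def quotientHom {G : Type*} [LieRing G] [LieAlgebra ℂ G] (I : LieIdeal ℂ G) : G →ₗ⁅ℂ⁆ G ⧸ I where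
  toFun x := LieSubmodule.Quotient.mk x
  map_add' _ _ := rfl
  map_smul' _ _ := rfl
  map_lie' := rfl

theorem quotientHom_surjective {G : Type*} [LieRing G] [LieAlgebra ℂ G] (I : LieIdeal ℂ G) :
    Function.Surjective (quotientHom I) := Quot.mk_surjective

theorem quotientHom_eq_zero {G : Type*} [LieRing G] [LieAlgebra ℂ G] (I : LieIdeal ℂ G) {x : G} :
    quotientHom I x = 0 ↔ x ∈ I := LieSubmodule.Quotient.mk_eq_zero'

namespace Realization

variable {ι : Type*} [Fintype ι] {A : GenCartanMatrix ι} {𝔥 : Type*}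
  [AddCommGroup 𝔥] [Module ℂ 𝔥] (R : Realization A 𝔥)

/-- Extending the coordinates linearly to all of `𝔥^*` involves a choice off the span of the simple
roots; only linearity and the values on simple roots matter. -/
theorem exists_coeff : ∃ c : Module.Dual ℂ 𝔥 →ₗ[ℂ] (ι →₀ ℂ),
    ∀ i, c (R.root i) = Finsupp.single i 1 := by
  obtain ⟨c, hc⟩ := LinearMap.exists_leftInverse_of_injective
    (Finsupp.linearCombination ℂ R.root) (LinearMap.ker_eq_bot.2 R.root_indep)
  refine ⟨c, fun i => ?_⟩
  have := congrArg (fun φ => φ (Finsupp.single i 1)) hc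
  simpa using this

/-- Coordinates with respect to the simple roots. -/
noncomputable def coeff : Module.Dual ℂ 𝔥 →ₗ[ℂ] (ι →₀ ℂ) := R.exists_coeff.choose

theorem coeff_root (i : ι) : R.coeff (R.root i) = Finsupp.single i 1 :=
  R.exists_coeff.choose_spec i

theorem exists_root_eq (r : ι → ℂ) : ∃ t : 𝔥, ∀ i, R.root i t = r i := by
  have := R.finite
  let φ : Module.Dual ℂ (Module.Dual ℂ 𝔥) := (Finsupp.linearCombination ℂ r).comp R.coeff
  refine ⟨(Module.evalEquiv ℂ 𝔥).symm φ, fun i => ?_⟩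
  rw [← Module.Dual.eval_apply, ← Module.evalEquiv_apply, LinearEquiv.apply_symm_apply]
  simp [φ, coeff_root]

end Realization

/-! ### Ideals which meet the Cartan subalgebra trivially -/

namespace ChevalleySystem

variable {ι : Type*} [Fintype ι] {A : GenCartanMatrix ι} {𝔥 : Type*}
  [AddCommGroup 𝔥] [Module ℂ 𝔥] {R : Realization A 𝔥} {G : Type*} [LieRing G]
  [LieAlgebra ℂ G] {C : ChevalleySystem R G}

/-- The image of a Chevalley system under a morphism. -/
def map (C : ChevalleySystem R G) {G' : Type*} [LieRing G'] [LieAlgebra ℂ G'] (φ : G →ₗ⁅ℂ⁆ G') :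
    ChevalleySystem R G' where
  e i := φ (C.e i)
  f i := φ (C.f i)
  h := φ.toLinearMap.comp C.h
  lie_h_h x y := by simp [← LieHom.map_lie, C.lie_h_h]
  lie_h_e x i := by simp [← LieHom.map_lie, C.lie_h_e]
  lie_h_f x i := by simp [← LieHom.map_lie, C.lie_h_f]
  lie_e_f_same i := by simp [← LieHom.map_lie, C.lie_e_f_same]
  lie_e_f_ne i j hij := by simp [← LieHom.map_lie, C.lie_e_f_ne i j hij]

theorem Generates.map (hC : C.Generates) {G' : Type*} [LieRing G'] [LieAlgebra ℂ G']
    {φ : G →ₗ⁅ℂ⁆ G'} (hφ : Function.Surjective φ) : (C.map φ).Generates := by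
  intro S he hf hh
  have := hC (S.comap φ) he hf hh
  rw [eq_top_iff]
  intro y _
  obtain ⟨x, rfl⟩ := hφ y
  exact (this ▸ LieSubalgebra.mem_top x : x ∈ S.comap φ)

-- The element `t` grades by length: `ad (h t)` acts on an iterated bracket of length `n ≥ 1` by `n`
-- or `-n`, never by zero. A polynomial with `p(0) ≠ 0` thus separates these brackets from `𝔥`,
-- where it acts by `p(0)`.
open Polynomial in
theorem exists_polynomial {t : 𝔥} (ht : ∀ i, R.root i t = 1) {z : G}
    (hz : z ∈ Submodule.span ℂ (Set.range C.mono ∪ Set.range C.swap.mono)) :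
    ∃ p : ℂ[X], p.eval 0 ≠ 0 ∧ aeval (LieAlgebra.ad ℂ G (C.h t)) p z = 0 := by
  have hsum (l : List ι) : (l.map R.root).sum t = l.length := by
    induction l with
    | nil => simp
    | cons i l ih => simp [ih, ht, add_comm]
  induction hz using Submodule.span_induction with
  | mem z hz =>
    rcases hz with ⟨l, rfl⟩ | ⟨l, rfl⟩
    · by_cases hl : l = []
      · subst hl
        exact ⟨1, by simp, by simp [mono]⟩
      · refine ⟨X - Polynomial.C (l.length : ℂ), by simpa using hl, ?_⟩
        have := C.mono_mem_weightSpace l t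
        rw [hsum] at this
        rw [map_sub, aeval_X, aeval_C, LinearMap.sub_apply, Module.algebraMap_end_apply,
          LieAlgebra.ad_apply, this, sub_self]
    · by_cases hl : l = []
      · subst hl
        exact ⟨1, by simp, by simp [mono]⟩
      · refine ⟨X + Polynomial.C (l.length : ℂ), by simpa using hl, ?_⟩
        have := C.mem_swap_weightSpace.1 (C.swap.mono_mem_weightSpace l) t
        rw [LinearMap.neg_apply, hsum] at this
        rw [map_add, aeval_X, aeval_C, LinearMap.add_apply, Module.algebraMap_end_apply,
          LieAlgebra.ad_apply, this, neg_smul, neg_add_cancel]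
  | zero => exact ⟨1, by simp, by simp⟩
  | add x y _ _ hx hy =>
    obtain ⟨p, hp, hpx⟩ := hx
    obtain ⟨q, hq, hqy⟩ := hy
    refine ⟨p * q, by simp [hp, hq], ?_⟩
    rw [map_add, map_mul, Module.End.mul_apply, Module.End.mul_apply, hqy, map_zero, add_zero,
      ← Module.End.mul_apply, ← map_mul, mul_comm, map_mul, Module.End.mul_apply, hpx, map_zero]
  | smul c x _ hx =>
    obtain ⟨p, hp, hpx⟩ := hx
    exact ⟨p, hp, by rw [map_smul, hpx, smul_zero]⟩

open Polynomial in
theorem aeval_ad_h (t x : 𝔥) (p : ℂ[X]) :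
    aeval (LieAlgebra.ad ℂ G (C.h t)) p (C.h x) = p.eval 0 • C.h x := by
  by_cases h0 : C.h x = 0
  · simp [h0]
  · exact Module.End.aeval_apply_of_hasEigenvector
      ⟨Module.End.mem_eigenspace_iff.2 (by simp [C.lie_h_h]), h0⟩

/-- The sum of all ideals which intersect the Cartan subalgebra trivially intersects it
trivially. -/
theorem Generates.h_eq_zero_of_mem_sSup (hC : C.Generates) {x : 𝔥}
    (hx : C.h x ∈ sSup {I : LieIdeal ℂ G | ∀ y : 𝔥, C.h y ∈ I → C.h y = 0}) : C.h x = 0 := by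
  obtain ⟨t, ht⟩ := R.exists_root_eq fun _ => 1
  set Z := Submodule.span ℂ (Set.range C.mono ∪ Set.range C.swap.mono) with hZ
  -- For `z + h w` in `I`, the polynomial annihilating `z` leaves a nonzero multiple of `h w` in
  -- `I`, so `h w = 0`. Hence each such ideal, and therefore their sum, lies in `Z`, which meets `𝔥`
  -- only in zero.
  have hI (I : LieIdeal ℂ G) (hI : ∀ y : 𝔥, C.h y ∈ I → C.h y = 0) : I.toSubmodule ≤ Z := by
    intro y hy
    have hy' : y ∈ Z ⊔ Submodule.span ℂ (Set.range C.h) := by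
      rw [hZ, ← Submodule.span_union, hC.span_eq_top]
      trivial
    obtain ⟨z, hz, w, hw, rfl⟩ := Submodule.mem_sup.1 hy'
    rw [← LinearMap.coe_range, Submodule.span_eq] at hw
    obtain ⟨w, rfl⟩ := hw
    obtain ⟨p, hp, hpz⟩ := exists_polynomial ht hz
    have hpI (y : G) (hy : y ∈ I) : Polynomial.aeval (LieAlgebra.ad ℂ G (C.h t)) p y ∈ I := by
      have hpow (n : ℕ) : (LieAlgebra.ad ℂ G (C.h t) ^ n) y ∈ I := by
        induction n with
        | zero => exact hy
        | succ n ih =>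
          rw [pow_succ', Module.End.mul_apply]
          exact lie_mem_right ℂ G I _ _ ih
      rw [Polynomial.aeval_eq_sum_range, LinearMap.sum_apply]
      exact sum_mem fun n _ => I.smul_mem _ (hpow n)
    have := hpI _ hy
    rw [map_add, hpz, zero_add, aeval_ad_h] at this
    have := I.smul_mem (p.eval 0)⁻¹ this
    rw [smul_smul, inv_mul_cancel₀ hp, one_smul] at this
    rw [hI w this, add_zero]
    exact hz
  have hx' : C.h x ∈ Z := by
    have : (sSup {I : LieIdeal ℂ G | ∀ y : 𝔥, C.h y ∈ I → C.h y = 0}).toSubmodule ≤ Z := by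
      rw [LieSubmodule.sSup_toSubmodule_eq_iSup]
      exact iSup₂_le hI
    exact this hx
  obtain ⟨p, hp, hpz⟩ := exists_polynomial ht hx'
  rw [aeval_ad_h] at hpz
  exact (smul_eq_zero.1 hpz).resolve_left hp

end ChevalleySystem

/-! ### The Chevalley system of the Kac–Moody algebra -/

namespace Realization

variable {ι : Type u} [Fintype ι] {A : GenCartanMatrix ι} {𝔥 : Type v}
  [AddCommGroup 𝔥] [Module ℂ 𝔥] (R : Realization A 𝔥)

theorem quotientHom_relIdeal_eq_zero {x : R.Free} (hx : R.IsRelator x) :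
    quotientHom R.relIdeal x = 0 :=
  (quotientHom_eq_zero _).2 (LieSubmodule.subset_lieSpan hx)

/-- The Chevalley system of the presented Lie algebra. -/
noncomputable def preSystem : ChevalleySystem R R.PreAlgebra where
  e i := quotientHom R.relIdeal (R.fe i)
  f i := quotientHom R.relIdeal (R.ff i)
  h :=
    { toFun := fun x => quotientHom R.relIdeal (R.fh x)
      map_add' := fun x y => by
        have := R.quotientHom_relIdeal_eq_zero (IsRelator.add x y)
        rwa [map_sub, map_add, sub_eq_zero] at this
      map_smul' := fun c x => by
        have := R.quotientHom_relIdeal_eq_zero (IsRelator.smul c x)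
        rwa [map_sub, map_smul, sub_eq_zero] at this }
  lie_h_h x y := by
    have := R.quotientHom_relIdeal_eq_zero (IsRelator.hh x y)
    rwa [LieHom.map_lie] at this
  lie_h_e x i := by
    have := R.quotientHom_relIdeal_eq_zero (IsRelator.he x i)
    rwa [map_sub, map_smul, sub_eq_zero, LieHom.map_lie] at this
  lie_h_f x i := by
    have := R.quotientHom_relIdeal_eq_zero (IsRelator.hf x i)
    rwa [map_add, map_smul, LieHom.map_lie, ← eq_neg_iff_add_eq_zero] at this
  lie_e_f_same i := by
    have := R.quotientHom_relIdeal_eq_zero (IsRelator.ef_same i)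
    rwa [map_sub, sub_eq_zero, LieHom.map_lie] at this
  lie_e_f_ne i j hij := by
    have := R.quotientHom_relIdeal_eq_zero (IsRelator.ef_ne i j hij)
    rwa [LieHom.map_lie] at this

theorem preSystem_generates : R.preSystem.Generates := by
  intro S he hf hh
  have : S.comap (quotientHom R.relIdeal) = ⊤ := by
    refine freeLieAlgebra_eq_top _ fun g => ?_
    rcases g with i | i | x
    · exact he i
    · exact hf i
    · exact hh x
  rw [eq_top_iff]
  intro y _
  obtain ⟨x, rfl⟩ := quotientHom_surjective _ y
  exact (this ▸ LieSubalgebra.mem_top x : x ∈ S.comap (quotientHom R.relIdeal))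

/-- The Chevalley system of the Kac–Moody algebra. -/
noncomputable def system : ChevalleySystem R R.Algebra := R.preSystem.map (quotientHom R.radIdeal)

theorem system_generates : R.system.Generates :=
  R.preSystem_generates.map (quotientHom_surjective _)

theorem system_h_injective : Function.Injective R.system.h := by
  rw [injective_iff_map_eq_zero]
  intro x hx
  refine R.eq_zero_of_preCartan_eq_zero ?_
  exact R.preSystem_generates.h_eq_zero_of_mem_sSup ((quotientHom_eq_zero _).1 hx)

theorem coroot_ne_zero (i : ι) : R.coroot i ≠ 0 := fun h => by
  have := R.pairing i i
  rw [h, map_zero, A.diag] at this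
  norm_num at this

theorem system_e_ne_zero (i : ι) : R.system.e i ≠ 0 := fun h => by
  have := R.system.lie_e_f_same i
  rw [h, zero_lie, eq_comm] at this
  exact R.coroot_ne_zero i (R.system_h_injective (this.trans (map_zero _).symm))

theorem system_serre_e {i j : ι} (hij : i ≠ j) :
    (LieAlgebra.ad ℂ R.Algebra (R.system.e i) ^ (1 - A.a i j).toNat) (R.system.e j) = 0 := by
  have := congrArg (quotientHom R.radIdeal)
    (R.quotientHom_relIdeal_eq_zero (IsRelator.serre_e i j hij))
  rwa [map_ad_pow, map_ad_pow, map_zero] at this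

theorem system_serre_f {i j : ι} (hij : i ≠ j) :
    (LieAlgebra.ad ℂ R.Algebra (R.system.f i) ^ (1 - A.a i j).toNat) (R.system.f j) = 0 := by
  have := congrArg (quotientHom R.radIdeal)
    (R.quotientHom_relIdeal_eq_zero (IsRelator.serre_f i j hij))
  rwa [map_ad_pow, map_ad_pow, map_zero] at this

end Realization

/-- The elements killed by some power of `ad (e i)` form a subalgebra (the Engel subalgebra), so
only generators need checking; the Serre relations handle the `e j`. -/
theorem ChevalleySystem.Generates.exists_ad_e_pow {ι : Type*} [Fintype ι] {A : GenCartanMatrix ι}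
    {𝔥 : Type*} [AddCommGroup 𝔥] [Module ℂ 𝔥] {R : Realization A 𝔥} {G : Type*} [LieRing G]
    [LieAlgebra ℂ G] {C : ChevalleySystem R G} (hC : C.Generates)
    (hS : ∀ i j, i ≠ j → (LieAlgebra.ad ℂ G (C.e i) ^ (1 - A.a i j).toNat) (C.e j) = 0)
    (i : ι) (x : G) : ∃ n : ℕ, (LieAlgebra.ad ℂ G (C.e i) ^ n) x = 0 := by
  have hh (x : 𝔥) : (LieAlgebra.ad ℂ G (C.e i) ^ 2) (C.h x) = 0 := by
    rw [pow_two, Module.End.mul_apply, LieAlgebra.ad_apply, LieAlgebra.ad_apply,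
      ← lie_skew (C.e i) (C.h x), C.lie_h_e]
    simp
  have := hC (LieSubalgebra.engel ℂ (C.e i)) (fun j => ?_) (fun j => ?_) (fun x => ?_)
  · exact (LieSubalgebra.mem_engel_iff ℂ _ _).1 (this ▸ LieSubalgebra.mem_top x)
  · by_cases hij : i = j
    · subst hij
      exact LieSubalgebra.self_mem_engel ℂ _
    · exact (LieSubalgebra.mem_engel_iff ℂ _ _).2 ⟨_, hS i j hij⟩
  · rw [LieSubalgebra.mem_engel_iff]
    by_cases hij : i = j
    · subst hij
      refine ⟨3, ?_⟩
      rw [pow_succ, Module.End.mul_apply, LieAlgebra.ad_apply, C.lie_e_f_same, hh]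
    · exact ⟨1, by simp [C.lie_e_f_ne i j hij]⟩
  · exact (LieSubalgebra.mem_engel_iff ℂ _ _).2 ⟨2, hh x⟩

/-! ### Properties of the root system -/

namespace Realization

variable {ι : Type u} [Fintype ι] {A : GenCartanMatrix ι} {𝔥 : Type v}
  [AddCommGroup 𝔥] [Module ℂ 𝔥] (R : Realization A 𝔥)

theorem mem_roots {β : Module.Dual ℂ 𝔥} : β ∈ R.roots ↔ β ≠ 0 ∧ R.system.IsWeight β := by
  refine and_congr_right fun _ => ⟨?_, ?_⟩
  · rintro ⟨x, hx, h⟩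
    exact ⟨x, h, hx⟩
  · rintro ⟨x, h, hx⟩
    exact ⟨x, hx, h⟩

theorem root_mem_roots (i : ι) : R.root i ∈ R.roots :=
  R.mem_roots.2 ⟨R.root_indep.ne_zero i, _, R.system.e_mem_weightSpace i, R.system_e_ne_zero i⟩

theorem reflection_mem_roots (i : ι) {β : Module.Dual ℂ 𝔥} (hβ : β ∈ R.roots) :
    R.simpleReflection i β ∈ R.roots := by
  rw [mem_roots] at hβ ⊢
  refine ⟨by simpa using hβ.1, R.system.isWeight_reflection
    (R.system_generates.exists_ad_e_pow (fun _ _ => R.system_serre_e) i) ?_ hβ.2⟩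
  exact R.system_generates.swap.exists_ad_e_pow (fun _ _ => R.system_serre_f) i

/-- The monoid `ℤ_{≥ 0} Π`. -/
def rootMonoid : AddSubmonoid (Module.Dual ℂ 𝔥) := AddSubmonoid.closure (Set.range R.root)

theorem list_sum_mem_rootMonoid (l : List ι) : (l.map R.root).sum ∈ R.rootMonoid :=
  AddSubmonoid.list_sum_mem _ fun x hx => by
    obtain ⟨i, _, rfl⟩ := List.mem_map.1 hx
    exact AddSubmonoid.subset_closure ⟨i, rfl⟩

theorem roots_pos_or_neg {β : Module.Dual ℂ 𝔥} (hβ : β ∈ R.roots) :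
    β ∈ R.rootMonoid ∨ -β ∈ R.rootMonoid := by
  rw [mem_roots] at hβ
  rcases R.system_generates.isWeight_cases hβ.2 hβ.1 with ⟨l, _, h⟩ | ⟨l, _, h⟩
  · exact Or.inl (h ▸ R.list_sum_mem_rootMonoid l)
  · exact Or.inr (h ▸ R.list_sum_mem_rootMonoid l)

theorem exists_coeff_eq_natCast {β : Module.Dual ℂ 𝔥} (hβ : β ∈ R.rootMonoid) (i : ι) :
    ∃ n : ℕ, R.coeff β i = n := by
  induction hβ using AddSubmonoid.closure_induction with
  | mem x hx =>
    obtain ⟨j, rfl⟩ := hx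
    classical
    rw [coeff_root, Finsupp.single_apply]
    by_cases h : j = i
    · exact ⟨1, by simp [h]⟩
    · exact ⟨0, by simp [h]⟩
  | zero => exact ⟨0, by simp⟩
  | add x y _ _ hx hy =>
    obtain ⟨m, hm⟩ := hx
    obtain ⟨n, hn⟩ := hy
    exact ⟨m + n, by simp [hm, hn]⟩

theorem eq_sum_coeff {β : Module.Dual ℂ 𝔥} (hβ : β ∈ R.rootMonoid) :
    β = ∑ i, R.coeff β i • R.root i := by
  induction hβ using AddSubmonoid.closure_induction with
  | mem x hx =>
    obtain ⟨j, rfl⟩ := hx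
    rw [coeff_root, Finset.sum_eq_single j]
    · simp
    · intro i _ hi
      simp [hi.symm]
    · simp
  | zero => simp
  | add x y _ _ hx hy =>
    nth_rw 1 [hx, hy]
    simp [add_smul, Finset.sum_add_distrib]

end Realization

/-! ### Positive roots outside `Δ_J` -/

namespace Realization

variable {ι : Type u} [Fintype ι] {A : GenCartanMatrix ι} {𝔥 : Type v}
  [AddCommGroup 𝔥] [Module ℂ 𝔥] (R : Realization A 𝔥)

theorem simpleReflection_apply (i : ι) (μ : Module.Dual ℂ 𝔥) :
    R.simpleReflection i μ = μ - μ (R.coroot i) • R.root i := by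
  rw [simpleReflection, Module.reflection_apply, Module.Dual.eval_apply]

theorem coeff_reflection_of_ne {i k : ι} (h : i ≠ k) (μ : Module.Dual ℂ 𝔥) :
    R.coeff (R.simpleReflection i μ) k = R.coeff μ k := by
  rw [simpleReflection_apply, map_sub, map_smul, coeff_root]
  simp [h.symm]

theorem coeff_list_sum (l : List ι) (k : ι) [DecidableEq ι] :
    R.coeff (l.map R.root).sum k = l.count k := by
  induction l with
  | nil => simp
  | cons i l ih =>
    rw [List.map_cons, List.sum_cons, map_add, Finsupp.add_apply, ih, coeff_root, List.count_cons,
      Finsupp.single_apply]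
    by_cases h : i = k
    · simp [h, add_comm]
    · simp [h]

theorem coeff_list_sum_ne_zero {l : List ι} {k : ι} :
    R.coeff (l.map R.root).sum k ≠ 0 ↔ k ∈ l := by
  classical
  rw [coeff_list_sum, Nat.cast_ne_zero, ← Nat.pos_iff_ne_zero, List.count_pos_iff]

theorem coeff_eq_zero_of_mem_closure {J : Set ι} {β : Module.Dual ℂ 𝔥}
    (hβ : β ∈ AddSubgroup.closure (R.root '' J)) {i : ι} (hi : i ∉ J) : R.coeff β i = 0 := by
  induction hβ using AddSubgroup.closure_induction with
  | mem x hx =>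
    obtain ⟨j, hj, rfl⟩ := hx
    have : i ≠ j := fun h => hi (h ▸ hj)
    rw [coeff_root, Finsupp.single_eq_of_ne this]
  | zero => simp
  | add x y _ _ hx hy => simp [hx, hy]
  | neg x _ hx => simp [hx]

/-- Positive roots outside `Δ_J`. -/
theorem mem_posRoots_diff {J : Set ι} {β : Module.Dual ℂ 𝔥} :
    β ∈ R.posRoots \ R.subPosRoots J ↔
      β ∈ R.roots ∧ β ∈ R.rootMonoid ∧ ∃ i ∉ J, R.coeff β i ≠ 0 := by
  constructor
  · rintro ⟨⟨h₁, h₂⟩, h₃⟩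
    refine ⟨h₁, h₂, ?_⟩
    by_contra! hcon
    refine h₃ ⟨⟨h₁, ?_⟩, h₁, h₂⟩
    rw [R.eq_sum_coeff h₂]
    refine sum_mem fun i _ => ?_
    by_cases hi : i ∈ J
    · obtain ⟨n, hn⟩ := R.exists_coeff_eq_natCast h₂ i
      rw [hn, Nat.cast_smul_eq_nsmul]
      exact nsmul_mem (AddSubgroup.subset_closure (Set.mem_image_of_mem _ hi)) n
    · rw [hcon i hi, zero_smul]
      exact zero_mem _
  · rintro ⟨h₁, h₂, i, hi, hc⟩
    exact ⟨⟨h₁, h₂⟩, fun h => hc (R.coeff_eq_zero_of_mem_closure h.1.2 hi)⟩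

/-- All coefficients of a root have the same sign, so one positive coefficient decides. -/
theorem mem_rootMonoid_of_coeff_natCast {β : Module.Dual ℂ 𝔥} (hβ : β ∈ R.roots) {i : ι} {n : ℕ}
    (hn : n ≠ 0) (h : R.coeff β i = n) : β ∈ R.rootMonoid := by
  refine (R.roots_pos_or_neg hβ).resolve_right fun hneg => hn ?_
  obtain ⟨m, hm⟩ := R.exists_coeff_eq_natCast hneg i
  rw [map_neg, Finsupp.neg_apply, h] at hm
  have : ((m + n : ℕ) : ℂ) = 0 := by push_cast; rw [← hm]; ring
  have := Nat.cast_eq_zero.1 this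
  omega

/-- The reflection changes only the coefficient at `j`, so a positive coefficient outside `J`
survives and keeps the root positive. -/
theorem reflection_mem_posRoots_diff {J : Set ι} {j : ι} (hj : j ∈ J) {β : Module.Dual ℂ 𝔥}
    (hβ : β ∈ R.posRoots \ R.subPosRoots J) :
    R.simpleReflection j β ∈ R.posRoots \ R.subPosRoots J := by
  rw [mem_posRoots_diff] at hβ ⊢
  obtain ⟨h₁, h₂, i, hi, hc⟩ := hβ
  have hij : j ≠ i := fun h => hi (h ▸ hj)
  obtain ⟨n, hn⟩ := R.exists_coeff_eq_natCast h₂ i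
  have h := R.reflection_mem_roots j h₁
  refine ⟨h, R.mem_rootMonoid_of_coeff_natCast h (n := n) (i := i) ?_ ?_, i, hi, ?_⟩
  · rintro rfl
    exact hc (by simpa using hn)
  · rw [R.coeff_reflection_of_ne hij, hn]
  · rwa [R.coeff_reflection_of_ne hij]

theorem root_mem_posRoots_diff {J : Set ι} {i : ι} (hi : i ∉ J) :
    R.root i ∈ R.posRoots \ R.subPosRoots J :=
  R.mem_posRoots_diff.2 ⟨R.root_mem_roots i, AddSubmonoid.subset_closure ⟨i, rfl⟩, i, hi, by
    simp [coeff_root]⟩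

/-- A positive root outside `Δ_J` is a simple root, or can be lowered inside the set of these
roots by a simple root. -/
theorem posRoots_diff_cases {J : Set ι} {β : Module.Dual ℂ 𝔥}
    (hβ : β ∈ R.posRoots \ R.subPosRoots J) :
    (∃ i ∉ J, β = R.root i) ∨ ∃ i, β - R.root i ∈ R.posRoots \ R.subPosRoots J := by
  have hβ' := hβ
  rw [mem_posRoots_diff] at hβ'
  obtain ⟨h₁, h₂, i, hi, hc⟩ := hβ'
  have hweight {k m : ι} (hk : k ∉ J) (hkm : m ≠ k) (hβk : R.coeff β k ≠ 0)
      (hw : R.system.IsWeight (β - R.root m)) : β - R.root m ∈ R.posRoots \ R.subPosRoots J := by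
    have hck : R.coeff (β - R.root m) k = R.coeff β k := by
      simp [coeff_root, hkm.symm]
    obtain ⟨n, hn⟩ := R.exists_coeff_eq_natCast h₂ k
    have hr : β - R.root m ∈ R.roots := by
      refine R.mem_roots.2 ⟨fun h0 => hβk ?_, hw⟩
      rw [← hck, h0]
      simp
    refine R.mem_posRoots_diff.2 ⟨hr, R.mem_rootMonoid_of_coeff_natCast hr (i := k) (n := n) ?_ ?_,
      k, hk, ?_⟩
    · rintro rfl
      exact hβk (by simpa using hn)
    · rw [hck, hn]
    · rwa [hck]
  have hpos : ∃ l, R.system.mono l ≠ 0 ∧ (l.map R.root).sum = β := by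
    refine (R.system_generates.isWeight_cases (R.mem_roots.1 h₁).2 (R.mem_roots.1 h₁).1).resolve_right
      ?_
    rintro ⟨l, _, hl⟩
    obtain ⟨n, hn⟩ := R.exists_coeff_eq_natCast h₂ i
    obtain ⟨m, hm⟩ := R.exists_coeff_eq_natCast (hl ▸ R.list_sum_mem_rootMonoid l) i
    rw [map_neg, Finsupp.neg_apply, hn] at hm
    have : ((m + n : ℕ) : ℂ) = 0 := by push_cast; rw [← hm]; ring
    have : n = 0 := by
      have := Nat.cast_eq_zero.1 this
      omega
    exact hc (by simp [hn, this])
  obtain ⟨l, hl, rfl⟩ := hpos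
  match l with
  | [] => simp at hc
  | [k] =>
    left
    have : i ∈ [k] := R.coeff_list_sum_ne_zero.1 hc
    obtain rfl : i = k := by simpa using this
    exact ⟨i, hi, by simp⟩
  | k :: m :: l =>
    right
    -- If the tail of the bracket has a letter outside `J`, the tail itself is a nonzero root vector
    -- of weight `β - α_k`.
    by_cases hex : ∃ p ∈ m :: l, p ∉ J
    · obtain ⟨p, hp, hpJ⟩ := hex
      refine ⟨k, ?_⟩
      have heq : ((k :: m :: l).map R.root).sum - R.root k = ((m :: l).map R.root).sum := by
        rw [List.map_cons, List.sum_cons, add_sub_cancel_left]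
      have hcp : R.coeff ((m :: l).map R.root).sum p ≠ 0 := R.coeff_list_sum_ne_zero.2 hp
      rw [heq]
      refine R.mem_posRoots_diff.2 ⟨R.mem_roots.2 ⟨fun h0 => hcp (by rw [h0]; simp), _,
        R.system.mono_mem_weightSpace _, ?_⟩, R.list_sum_mem_rootMonoid _, p, hpJ, hcp⟩
      intro h0
      rw [ChevalleySystem.mono, h0, lie_zero] at hl
      exact hl rfl
    · push Not at hex
      have hik : i = k := by
        have : i ∈ k :: m :: l := R.coeff_list_sum_ne_zero.1 hc
        rcases List.mem_cons.1 this with h | h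
        · exact h
        · exact absurd (hex i h) hi
      subst hik
      -- Now the head is the only letter outside `J`. Swapping the bracket makes the tail act on `e
      -- i`, so the simple root removed can be taken in `J`.
      rw [ChevalleySystem.mono, ← lie_skew, neg_ne_zero] at hl
      obtain ⟨j, hj, hw⟩ := R.system.exists_isWeight_of_lie_mono_ne_zero (m :: l)
        (R.system.e_mem_weightSpace i) hl
      refine ⟨j, hweight hi (fun h => hi (h ▸ hex j hj)) hc ?_⟩
      convert hw using 2
      rw [List.map_cons, List.sum_cons, add_comm]

/-! ### Words in the simple reflections -/

/-- The product of the simple reflections of a word. -/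
noncomputable def word (l : List ι) : Module.Dual ℂ 𝔥 ≃ₗ[ℂ] Module.Dual ℂ 𝔥 :=
  (l.map R.simpleReflection).prod

theorem word_nil (μ : Module.Dual ℂ 𝔥) : R.word [] μ = μ := rfl

theorem word_cons (i : ι) (l : List ι) (μ : Module.Dual ℂ 𝔥) :
    R.word (i :: l) μ = R.simpleReflection i (R.word l μ) := rfl

theorem simpleReflection_inv (i : ι) : (R.simpleReflection i)⁻¹ = R.simpleReflection i :=
  Module.reflection_symm _

theorem simpleReflection_mem {J : Set ι} {j : ι} (hj : j ∈ J) :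
    R.simpleReflection j ∈ R.parabolic J := Subgroup.subset_closure ⟨j, hj, rfl⟩

theorem exists_word_of_mem_parabolic {J : Set ι}
    {w : Module.Dual ℂ 𝔥 ≃ₗ[ℂ] Module.Dual ℂ 𝔥} (hw : w ∈ R.parabolic J) :
    ∃ l : List ι, (∀ j ∈ l, j ∈ J) ∧ w = R.word l := by
  induction hw using Subgroup.closure_induction'' with
  | one => exact ⟨[], by simp, rfl⟩
  | mem x hx =>
    obtain ⟨j, hj, rfl⟩ := hx
    exact ⟨[j], by simpa using hj, by simp [word]⟩
  | inv_mem x hx =>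
    obtain ⟨j, hj, rfl⟩ := hx
    exact ⟨[j], by simpa using hj, by simp [word, simpleReflection_inv]⟩
  | mul x y _ _ hx hy =>
    obtain ⟨l, hl, rfl⟩ := hx
    obtain ⟨m, hm, rfl⟩ := hy
    exact ⟨l ++ m, by simpa [or_imp, forall_and] using ⟨hl, hm⟩, by simp [word]⟩

/-- Induction on the elements of a parabolic subgroup, by multiplication with simple reflections
from the left. -/
theorem parabolic_induction {J : Set ι}
    {p : (Module.Dual ℂ 𝔥 ≃ₗ[ℂ] Module.Dual ℂ 𝔥) → Prop} (one : p 1)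
    (mul : ∀ j ∈ J, ∀ w, p w → p (R.simpleReflection j * w))
    {w : Module.Dual ℂ 𝔥 ≃ₗ[ℂ] Module.Dual ℂ 𝔥} (hw : w ∈ R.parabolic J) : p w := by
  obtain ⟨l, hl, rfl⟩ := R.exists_word_of_mem_parabolic hw
  clear hw
  induction l with
  | nil => exact one
  | cons i l ih =>
    exact mul i (hl i (List.mem_cons_self ..)) _ (ih fun j hj => hl j (List.mem_cons_of_mem _ hj))

end Realization

/-! ### Existence of realizations -/

/-- Complementing the range of the transposed matrix gives a surjection onto `ℂ^ι` whose coordinates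
are the simple roots. This is needed for the enlarged matrix `A.extend n`. -/
theorem exists_realization {ι : Type u} [Fintype ι] (A : GenCartanMatrix ι) :
    ∃ (𝔥 : Type u) (_ : AddCommGroup 𝔥) (_ : Module ℂ 𝔥), Nonempty (Realization A 𝔥) := by
  classical
  let M : Matrix ι ι ℂ := A.a.transpose.map (Int.cast : ℤ → ℂ)
  obtain ⟨K, hK⟩ := Submodule.exists_isCompl (LinearMap.range M.mulVecLin)
  let ρ : ((ι → ℂ) × K) →ₗ[ℂ] (ι → ℂ) := M.mulVecLin.coprod K.subtype
  have hρ : Function.Surjective ρ := by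
    rw [← LinearMap.range_eq_top, LinearMap.range_coprod, Submodule.range_subtype]
    exact hK.sup_eq_top
  refine ⟨(ι → ℂ) × K, inferInstance, inferInstance, ⟨{
    finite := inferInstance
    root := fun i => (LinearMap.proj i).comp ρ
    coroot := fun i => (Pi.single i 1, 0)
    root_indep := ?_
    coroot_indep := ?_
    pairing := ?_
    dim := ?_ }⟩⟩
  · rw [Fintype.linearIndependent_iff]
    intro g hg i
    obtain ⟨x, hx⟩ := hρ (Pi.single i 1)
    have := congrArg (fun φ => φ x) hg
    simpa [hx, Pi.single_apply] using this
  · rw [Fintype.linearIndependent_iff]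
    intro g hg i
    have := congrFun (congrArg Prod.fst hg) i
    simpa [Pi.single_apply, Prod.fst_sum] using this
  · intro i j
    simp [ρ, M]
  · have h1 : Module.finrank ℂ ((ι → ℂ) × K) = Fintype.card ι + Module.finrank ℂ K := by
      rw [Module.finrank_prod, Module.finrank_fintype_fun_eq_card]
    have h2 := Submodule.finrank_add_eq_of_isCompl hK
    rw [Module.finrank_fintype_fun_eq_card] at h2
    have h3 : (A.a.map (Int.cast : ℤ → ℂ)).rank = M.rank := by
      rw [← Matrix.rank_transpose]
      rfl
    rw [h1, h3, Matrix.rank]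
    omega

/-! ### Dominant forms -/

/-- The extension of a generalized Cartan matrix by a node which is joined to the node `i` by the
entries `-n i`. -/
def GenCartanMatrix.extend {ι : Type u} (A : GenCartanMatrix ι) (n : ι → ℕ) :
    GenCartanMatrix (Option ι) where
  a i j := match i, j with
    | none, none => 2
    | none, some j => -n j
    | some i, none => -n i
    | some i, some j => A.a i j
  diag i := by
    rcases i with _ | i
    · rfl
    · exact A.diag i
  off_diag i j hij := by
    rcases i with _ | i <;> rcases j with _ | j
    · exact absurd rfl hij
    · simp
    · simp
    · exact A.off_diag i j fun h => hij (by rw [h])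
  symm_zero i j h := by
    rcases i with _ | i <;> rcases j with _ | j
    · exact h
    · exact h
    · exact h
    · exact A.symm_zero i j h

namespace Realization

variable {ι : Type u} [Fintype ι] {A : GenCartanMatrix ι} {𝔥 : Type v}
  [AddCommGroup 𝔥] [Module ℂ 𝔥] (R : Realization A 𝔥)

/-- For dominant integral `lam`, `lam - w lam` is a sum of simple roots. -/
theorem exists_sub_word_eq {lam : Module.Dual ℂ 𝔥} {n : ι → ℕ} (hn : ∀ i, lam (R.coroot i) = n i)
    (l : List ι) : ∃ c : ι → ℕ, lam - R.word l lam = ∑ i, c i • R.root i := by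
  obtain ⟨𝔥', _, _, ⟨R'⟩⟩ := exists_realization (A.extend n)
  -- The new simple root pairs to `-n i` with the old coroots, so it transforms like `-lam`, and a
  -- word produces the same coefficients `c` in both settings.
  have key : ∃ c : ι → ℂ, lam - R.word l lam = ∑ i, c i • R.root i ∧
      R'.word (l.map some) (R'.root none) = R'.root none + ∑ i, c i • R'.root (some i) := by
    classical
    induction l with
    | nil => exact ⟨0, by simp [word_nil], by simp [word_nil]⟩
    | cons i l ih =>
      obtain ⟨c, hc, hc'⟩ := ih
      set b : ℂ := n i - ∑ k, c k * A.a i k with hb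
      have h₁ : (R.word l lam) (R.coroot i) = b := by
        rw [← sub_sub_self lam (R.word l lam), hc]
        simp [hn, R.pairing, hb]
      have h₂ : (R'.word (l.map some) (R'.root none)) (R'.coroot (some i)) = -b := by
        rw [hc']
        simp [R'.pairing, GenCartanMatrix.extend, hb, neg_add_eq_sub]
      refine ⟨c + Pi.single i b, ?_, ?_⟩
      · rw [word_cons, simpleReflection_apply, h₁, sub_sub_eq_add_sub, add_sub_right_comm, hc]
        simp [add_smul, Finset.sum_add_distrib, Pi.single_apply, ite_smul]
      · rw [List.map_cons, word_cons, simpleReflection_apply, h₂, hc']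
        simp [add_smul, Finset.sum_add_distrib, Pi.single_apply, ite_smul, add_assoc]
  obtain ⟨c, hc, hc'⟩ := key
  have hroot (l : List (Option ι)) : R'.word l (R'.root none) ∈ R'.roots := by
    induction l with
    | nil => exact R'.root_mem_roots none
    | cons i l ih => exact R'.reflection_mem_roots i ih
  have hr := hroot (l.map some)
  rw [hc'] at hr
  -- The image of the new simple root is a root with coefficient `1` at `none`, hence positive; so
  -- every `c i` is a natural number.
  have hpos := R'.mem_rootMonoid_of_coeff_natCast hr (i := none) (n := 1) one_ne_zero (by
    simp [coeff_root])
  have hnat (i : ι) : ∃ m : ℕ, c i = m := by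
    obtain ⟨m, hm⟩ := R'.exists_coeff_eq_natCast hpos (some i)
    refine ⟨m, ?_⟩
    classical
    simpa [coeff_root, Finsupp.single_apply] using hm
  choose m hm using hnat
  refine ⟨m, ?_⟩
  rw [hc]
  simp [hm, Nat.cast_smul_eq_nsmul]

theorem exists_fundamental (j : ι) : ∃ ω : Module.Dual ℂ 𝔥, ω (R.coroot j) = 1 ∧
    ∀ i, i ≠ j → ω (R.coroot i) = 0 := by
  obtain ⟨c, hc⟩ := LinearMap.exists_leftInverse_of_injective
    (Finsupp.linearCombination ℂ R.coroot) (LinearMap.ker_eq_bot.2 R.coroot_indep)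
  have hc' (i : ι) : c (R.coroot i) = Finsupp.single i 1 := by
    have := congrArg (fun φ => φ (Finsupp.single i 1)) hc
    simpa using this
  refine ⟨(Finsupp.lapply j).comp c, by simp [hc'], fun i hi => by simp [hc', hi.symm]⟩

end Realization

namespace Realization

variable {ι : Type u} [Fintype ι] {A : GenCartanMatrix ι} {𝔥 : Type v}
  [AddCommGroup 𝔥] [Module ℂ 𝔥] (R : Realization A 𝔥)

omit [Fintype ι] in
theorem map_real_smul (w : Module.Dual ℂ 𝔥 ≃ₗ[ℂ] Module.Dual ℂ 𝔥) (r : ℝ)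
    (μ : Module.Dual ℂ 𝔥) : w (r • μ) = r • w μ :=
  LinearMap.map_smul_of_tower w.toLinearMap r μ

theorem coeff_real_smul (r : ℝ) (μ : Module.Dual ℂ 𝔥) (i : ι) :
    R.coeff (r • μ) i = r * R.coeff μ i := by
  rw [← Complex.coe_smul, map_smul]
  rfl

/-! ### The real cone spanned by the simple roots -/

/-- The real cone spanned by the simple roots. -/
noncomputable abbrev rootCone : PointedCone ℝ (Module.Dual ℂ 𝔥) := PointedCone.hull ℝ (Set.range R.root)

theorem mem_rootCone {μ : Module.Dual ℂ 𝔥} :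
    μ ∈ R.rootCone ↔ ∃ c : ι → ℝ, (∀ i, 0 ≤ c i) ∧ μ = ∑ i, c i • R.root i := by
  rw [Submodule.mem_span_range_iff_exists_fun]
  constructor
  · rintro ⟨c, rfl⟩
    exact ⟨fun i => c i, fun i => (c i).2, rfl⟩
  · rintro ⟨c, hc, rfl⟩
    exact ⟨fun i => ⟨c i, hc i⟩, rfl⟩

theorem coeff_sum_smul (c : ι → ℝ) (k : ι) : R.coeff (∑ i, c i • R.root i) k = c k := by
  classical
  rw [map_sum, Finsupp.finsetSum_apply, Finset.sum_eq_single k]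
  · rw [coeff_real_smul, coeff_root]
    simp
  · intro i _ hi
    rw [coeff_real_smul, coeff_root, Finsupp.single_eq_of_ne hi.symm, mul_zero]
  · simp

/-- Linear independence makes the cone salient. This is used to recognize vertices, and to identify
two dominant forms in one orbit. -/
theorem eq_zero_of_add_eq_zero {μ ν : Module.Dual ℂ 𝔥} (hμ : μ ∈ R.rootCone)
    (hν : ν ∈ R.rootCone) (h : μ + ν = 0) : μ = 0 := by
  obtain ⟨c, hc, rfl⟩ := R.mem_rootCone.1 hμ
  obtain ⟨d, hd, rfl⟩ := R.mem_rootCone.1 hν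
  refine Finset.sum_eq_zero fun i _ => ?_
  have := congrArg (fun x => R.coeff x i) h
  simp only [map_add, Finsupp.add_apply, coeff_sum_smul, map_zero, Finsupp.zero_apply] at this
  have h' : c i + d i = 0 := by exact_mod_cast this
  have : c i = 0 := by linarith [hc i, hd i]
  rw [this, zero_smul]

theorem rootMonoid_le_rootCone {β : Module.Dual ℂ 𝔥} (hβ : β ∈ R.rootMonoid) :
    β ∈ R.rootCone := by
  induction hβ using AddSubmonoid.closure_induction with
  | mem x hx => exact Submodule.subset_span hx
  | zero => exact zero_mem _
  | add x y _ _ hx hy => exact add_mem hx hy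

/-- `w lam ≤ lam` for all `w ∈ W_J` if `lam` is `J`-dominant. -/
theorem sub_mem_rootCone {lam : Module.Dual ℂ 𝔥} {J : Set ι} (hJ : J ⊆ R.realDominant lam)
    {w : Module.Dual ℂ 𝔥 ≃ₗ[ℂ] Module.Dual ℂ 𝔥} (hw : w ∈ R.parabolic J) :
    lam - w lam ∈ R.rootCone := by
  classical
  have hr (j : ι) : ∃ r : ℝ, 0 ≤ r ∧ (j ∈ J → lam (R.coroot j) = r) := by
    by_cases hj : j ∈ J
    · obtain ⟨r, hr, h⟩ := hJ hj
      exact ⟨r, hr, fun _ => h⟩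
    · exact ⟨0, le_rfl, fun h => absurd h hj⟩
  choose r hr0 hr using hr
  choose ω hω hω' using R.exists_fundamental
  -- Subtracting the fundamental forms with nonnegative weights `r j` leaves a `W_J`-fixed form,
  -- reducing the claim to the integral forms `ω j`.
  set ν := lam - ∑ j, r j • ω j with hν
  have hνJ (j : ι) (hj : j ∈ J) : ν (R.coroot j) = 0 := by
    rw [hν, LinearMap.sub_apply, LinearMap.sum_apply, Finset.sum_eq_single j, hr j hj]
    · simp [hω]
    · intro i _ hi
      simp [hω' i j hi.symm]
    · simp
  have hwν : w ν = ν := by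
    refine R.parabolic_induction (p := fun w => w ν = ν) rfl (fun j hj w ih => ?_) hw
    rw [LinearEquiv.mul_apply, ih, simpleReflection_apply, hνJ j hj, zero_smul, sub_zero]
  have hlam : lam = ν + ∑ j, r j • ω j := by rw [hν]; abel
  have : lam - w lam = ∑ j, r j • (ω j - w (ω j)) := by
    conv_lhs => rw [hlam]
    rw [map_add, hwν, map_sum, add_sub_add_left_eq_sub, ← Finset.sum_sub_distrib]
    exact Finset.sum_congr rfl fun j _ => by rw [map_real_smul, smul_sub]
  rw [this]
  refine sum_mem fun j _ => PointedCone.smul_mem _ (hr0 j) ?_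
  obtain ⟨l, _, rfl⟩ := R.exists_word_of_mem_parabolic hw
  obtain ⟨c, hc⟩ := R.exists_sub_word_eq (lam := ω j) (n := Pi.single j 1) (fun i => by
    by_cases h : i = j
    · subst h; simp [hω]
    · simp [hω' j i h, h]) l
  rw [hc]
  exact sum_mem fun i _ => nsmul_mem (Submodule.subset_span (Set.mem_range_self i)) _

/-! ### The parabolic subgroup and coefficients -/

theorem coeff_parabolic {J : Set ι} {w : Module.Dual ℂ 𝔥 ≃ₗ[ℂ] Module.Dual ℂ 𝔥}
    (hw : w ∈ R.parabolic J) {i : ι} (hi : i ∉ J) (μ : Module.Dual ℂ 𝔥) :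
    R.coeff (w μ) i = R.coeff μ i := by
  refine R.parabolic_induction (p := fun w => R.coeff (w μ) i = R.coeff μ i) rfl
    (fun j hj w ih => ?_) hw
  have hji : j ≠ i := fun h => hi (h ▸ hj)
  rw [LinearEquiv.mul_apply, R.coeff_reflection_of_ne hji, ih]

theorem parabolic_mem_posRoots_diff {J : Set ι} {w : Module.Dual ℂ 𝔥 ≃ₗ[ℂ] Module.Dual ℂ 𝔥}
    (hw : w ∈ R.parabolic J) {β : Module.Dual ℂ 𝔥} (hβ : β ∈ R.posRoots \ R.subPosRoots J) :
    w β ∈ R.posRoots \ R.subPosRoots J :=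
  R.parabolic_induction (p := fun w => w β ∈ R.posRoots \ R.subPosRoots J) hβ
    (fun _ hj _ ih => R.reflection_mem_posRoots_diff hj ih) hw

theorem parabolic_mono {J J' : Set ι} (h : J ⊆ J') : R.parabolic J ≤ R.parabolic J' :=
  Subgroup.closure_mono (Set.image_mono h)

theorem reflection_reflection (i : ι) (μ : Module.Dual ℂ 𝔥) :
    R.simpleReflection i (R.simpleReflection i μ) = μ :=
  Module.involutive_reflection _ _

theorem exists_intCast_eq {β : Module.Dual ℂ 𝔥} (hβ : β ∈ R.rootMonoid) (j : ι) :
    ∃ m : ℤ, β (R.coroot j) = m := by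
  induction hβ using AddSubmonoid.closure_induction with
  | mem x hx =>
    obtain ⟨i, rfl⟩ := hx
    exact ⟨_, R.pairing j i⟩
  | zero => exact ⟨0, by simp⟩
  | add x y _ _ hx hy =>
    obtain ⟨m, hm⟩ := hx
    obtain ⟨n, hn⟩ := hy
    exact ⟨m + n, by simp [hm, hn]⟩

/-- The height of a linear form. -/
noncomputable def height : Module.Dual ℂ 𝔥 →ₗ[ℂ] ℂ :=
  (Finsupp.linearCombination ℂ fun _ : ι => (1 : ℂ)).comp R.coeff

theorem height_root (i : ι) : R.height (R.root i) = 1 := by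
  simp [height, coeff_root]

theorem exists_height_eq {β : Module.Dual ℂ 𝔥} (hβ : β ∈ R.rootMonoid) :
    ∃ n : ℕ, R.height β = n := by
  induction hβ using AddSubmonoid.closure_induction with
  | mem x hx =>
    obtain ⟨i, rfl⟩ := hx
    exact ⟨1, by simp [height_root]⟩
  | zero => exact ⟨0, by simp⟩
  | add x y _ _ hx hy =>
    obtain ⟨m, hm⟩ := hx
    obtain ⟨n, hn⟩ := hy
    exact ⟨m + n, by simp [hm, hn]⟩

/-- Induction on the height for positive roots outside `Δ_J`. -/
theorem posRoots_diff_induction {J : Set ι} {p : Module.Dual ℂ 𝔥 → Prop}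
    (step : ∀ β ∈ R.posRoots \ R.subPosRoots J,
      (∀ γ ∈ R.posRoots \ R.subPosRoots J, ∀ m : ℕ, 0 < m → R.height γ + m = R.height β → p γ) →
      p β) {β : Module.Dual ℂ 𝔥} (hβ : β ∈ R.posRoots \ R.subPosRoots J) : p β := by
  obtain ⟨n, hn⟩ := R.exists_height_eq hβ.1.2
  induction n using Nat.strong_induction_on generalizing β with
  | _ n ih =>
    refine step β hβ fun γ hγ m hm h => ?_
    obtain ⟨k, hk⟩ := R.exists_height_eq hγ.1.2
    refine ih k ?_ hγ hk
    rw [hk, hn] at h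
    have : k + m = n := by exact_mod_cast h
    omega

theorem height_reflection {j : ι} {β : Module.Dual ℂ 𝔥} {m : ℤ} (hm : β (R.coroot j) = m)
    (hpos : 0 < m) : R.height (R.simpleReflection j β) + m.toNat = R.height β := by
  have : ((m.toNat : ℕ) : ℂ) = m := by
    have h : (m.toNat : ℤ) = m := Int.toNat_of_nonneg hpos.le
    exact_mod_cast congrArg (fun z : ℤ => (z : ℂ)) h
  rw [simpleReflection_apply, map_sub, map_smul, height_root, hm, this]
  simp

/-! ### The cone spanned by the positive roots outside `Δ_J` -/

/-- The images of the simple roots outside `J` under `W_J`. -/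
def nilOrbit (J : Set ι) : Set (Module.Dual ℂ 𝔥) :=
  {β | ∃ w ∈ R.parabolic J, ∃ i ∉ J, β = w (R.root i)}

theorem nilOrbit_subset (J : Set ι) : R.nilOrbit J ⊆ R.posRoots \ R.subPosRoots J := by
  rintro β ⟨w, hw, i, hi, rfl⟩
  exact R.parabolic_mem_posRoots_diff hw (R.root_mem_posRoots_diff hi)

theorem reflection_mem_hull {J : Set ι} {j : ι} (hj : j ∈ J) {μ : Module.Dual ℂ 𝔥}
    (hμ : μ ∈ PointedCone.hull ℝ (R.nilOrbit J)) :
    R.simpleReflection j μ ∈ PointedCone.hull ℝ (R.nilOrbit J) := by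
  induction hμ using Submodule.span_induction with
  | mem x hx =>
    obtain ⟨w, hw, i, hi, rfl⟩ := hx
    exact Submodule.subset_span ⟨_, mul_mem (R.simpleReflection_mem hj) hw, i, hi, rfl⟩
  | zero => rw [map_zero]; exact zero_mem _
  | add x y _ _ hx hy => rw [map_add]; exact add_mem hx hy
  | smul c x _ hx =>
    change R.simpleReflection j ((c : ℝ) • x) ∈ _
    rw [map_real_smul]
    exact PointedCone.smul_mem _ c.2 hx

/-- Induction on height: a reflection from `J` lowers `β`, or else `β` is simple or exceeds a
smaller root `γ` of the same set by a simple root. -/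
theorem mem_hull_nilOrbit {J : Set ι} {β : Module.Dual ℂ 𝔥}
    (hβ : β ∈ R.posRoots \ R.subPosRoots J) : β ∈ PointedCone.hull ℝ (R.nilOrbit J) := by
  refine R.posRoots_diff_induction (p := fun β => β ∈ PointedCone.hull ℝ (R.nilOrbit J)) ?_ hβ
  intro β hβ ih
  by_cases hex : ∃ j ∈ J, ∃ m : ℤ, 0 < m ∧ β (R.coroot j) = m
  · obtain ⟨j, hj, m, hm, hβj⟩ := hex
    have := ih _ (R.reflection_mem_posRoots_diff hj hβ) m.toNat (by omega)
      (R.height_reflection hβj hm)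
    rw [← R.reflection_reflection j β]
    exact R.reflection_mem_hull hj this
  · push Not at hex
    have hroot (i : ι) (hi : i ∉ J) : R.root i ∈ PointedCone.hull ℝ (R.nilOrbit J) :=
      Submodule.subset_span ⟨1, one_mem _, i, hi, rfl⟩
    rcases R.posRoots_diff_cases hβ with ⟨i, hi, rfl⟩ | ⟨i, hγ⟩
    · exact hroot i hi
    · have hγK := ih _ hγ 1 one_pos (by simp [height_root])
      by_cases hi : i ∈ J
      · obtain ⟨m, hm⟩ := R.exists_intCast_eq hβ.1.2 i
        have hm0 : m ≤ 0 := by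
          by_contra! hcon
          exact hex i hi m hcon hm
        set γ := β - R.root i with hγdef
        -- Since `⟨γ, coroot i⟩ = m - 2`, the reflection of `γ` is `γ + (2 - m) α_i`. As `m ≤ 0`, `β
        -- = γ + α_i` lies on the segment from `γ` to its reflection, at parameter `1/(2 - m)`.
        have hq : (0 : ℝ) < 2 - m := by
          have : (m : ℝ) ≤ 0 := by exact_mod_cast hm0
          linarith
        have hsγ : R.simpleReflection i γ = γ + (2 - m : ℝ) • R.root i := by
          rw [simpleReflection_apply, sub_eq_add_neg, ← neg_smul, ← Complex.coe_smul]
          congr 2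
          rw [hγdef, LinearMap.sub_apply, hm, R.pairing, A.diag]
          push_cast
          ring
        have hβeq : β = (1 - (2 - m : ℝ)⁻¹) • γ + (2 - m : ℝ)⁻¹ • R.simpleReflection i γ := by
          rw [hsγ, smul_add, smul_smul, inv_mul_cancel₀ hq.ne', one_smul, ← add_assoc, ← add_smul,
            sub_add_cancel, one_smul, hγdef, sub_add_cancel]
        rw [hβeq]
        refine add_mem (PointedCone.smul_mem _ ?_ hγK)
          (PointedCone.smul_mem _ (inv_nonneg.2 hq.le) (R.reflection_mem_hull hi hγK))
        rw [sub_nonneg]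
        refine inv_le_one_of_one_le₀ ?_
        have : (m : ℝ) ≤ 0 := by exact_mod_cast hm0
        linarith
      · rw [← sub_add_cancel β (R.root i)]
        exact add_mem hγK (hroot i hi)

theorem hull_posRoots_diff (J : Set ι) :
    PointedCone.hull ℝ (R.posRoots \ R.subPosRoots J) = PointedCone.hull ℝ (R.nilOrbit J) :=
  le_antisymm (Submodule.span_le.2 fun _ h => R.mem_hull_nilOrbit h)
    (Submodule.span_mono (R.nilOrbit_subset J))

theorem parabolic_mem_hull {J : Set ι} {w : Module.Dual ℂ 𝔥 ≃ₗ[ℂ] Module.Dual ℂ 𝔥}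
    (hw : w ∈ R.parabolic J) {μ : Module.Dual ℂ 𝔥}
    (hμ : μ ∈ PointedCone.hull ℝ (R.nilOrbit J)) :
    w μ ∈ PointedCone.hull ℝ (R.nilOrbit J) :=
  R.parabolic_induction (p := fun w => w μ ∈ PointedCone.hull ℝ (R.nilOrbit J)) hμ
    (fun _ hj _ ih => R.reflection_mem_hull hj ih) hw

theorem hull_nilOrbit_le (J : Set ι) : PointedCone.hull ℝ (R.nilOrbit J) ≤ R.rootCone :=
  Submodule.span_le.2 fun _ hβ => R.rootMonoid_le_rootCone (R.nilOrbit_subset J hβ).1.2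

/-- Splitting off one generator supplies the candidate direction of an extremal ray. -/
theorem eq_zero_or_exists_add_smul {J : Set ι} {κ : Module.Dual ℂ 𝔥}
    (hκ : κ ∈ PointedCone.hull ℝ (R.nilOrbit J)) : κ = 0 ∨ ∃ β ∈ R.nilOrbit J, ∃ c : ℝ, 0 < c ∧
      ∃ κ' ∈ PointedCone.hull ℝ (R.nilOrbit J), κ = κ' + c • β := by
  induction hκ using Submodule.span_induction with
  | mem x hx => exact Or.inr ⟨x, hx, 1, one_pos, 0, zero_mem _, by simp⟩
  | zero => exact Or.inl rfl
  | add x y _ hy hx' hy' =>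
    rcases hx' with rfl | ⟨β, hβ, c, hc, κ', hκ', rfl⟩
    · rwa [zero_add]
    · exact Or.inr ⟨β, hβ, c, hc, κ' + y, add_mem hκ' hy, by abel⟩
  | smul a x _ hx =>
    rcases hx with rfl | ⟨β, hβ, c, hc, κ', hκ', rfl⟩
    · exact Or.inl (smul_zero _)
    · rcases eq_or_lt_of_le a.2 with h | h
      · left
        rw [show a = 0 from Subtype.ext h.symm, zero_smul]
      · refine Or.inr ⟨β, hβ, a * c, mul_pos h hc, (a : ℝ) • κ',
          PointedCone.smul_mem _ a.2 hκ', ?_⟩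
        rw [smul_add]
        exact congrArg _ (smul_smul (a : ℝ) c β)

end Realization

/-! ### Extremal rays -/

section Rays

variable {E : Type*} [AddCommGroup E] [Module ℝ E] {C : Set E} {x : E} {ρ : Set E}

theorem mem_ray_self (x y : E) : x ∈ ray x y := ⟨0, le_rfl, by simp⟩

theorem ray_smul {c : ℝ} (hc : 0 < c) (x y : E) : ray x (c • y) = ray x y := by
  ext z
  constructor
  · rintro ⟨r, hr, rfl⟩
    exact ⟨r * c, mul_nonneg hr hc.le, by rw [smul_smul]⟩
  · rintro ⟨r, hr, rfl⟩
    exact ⟨r * c⁻¹, mul_nonneg hr (inv_nonneg.2 hc.le), by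
      rw [smul_smul, mul_assoc, inv_mul_cancel₀ hc.ne', mul_one]⟩

theorem image_ray (φ : E ≃ₗ[ℝ] E) (x y : E) : φ '' ray x y = ray (φ x) (φ y) := by
  ext z
  constructor
  · rintro ⟨_, ⟨r, hr, rfl⟩, rfl⟩
    exact ⟨r, hr, by simp⟩
  · rintro ⟨r, hr, rfl⟩
    exact ⟨_, ⟨r, hr, rfl⟩, by simp⟩

theorem IsExtremalRayAt.mem_of_combination (h : IsExtremalRayAt C x ρ) {a b : E} (ha : a ∈ C)
    (hb : b ∈ C) {s t : ℝ} (hs : 0 < s) (ht : 0 < t) (hst : s + t = 1)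
    (hab : s • a + t • b ∈ ρ) : a ∈ ρ ∧ b ∈ ρ := by
  obtain ⟨y, hy, rfl, hC, h⟩ := h
  obtain ⟨r, hr, hr'⟩ := hab
  have key := h r 2 ![s, t] ![a, b] hr (by simp [Fin.forall_fin_two, hs.le, ht.le])
    (by simpa [Fin.sum_univ_two] using hst) (by simp [Fin.forall_fin_two, ha, hb])
    (by simpa [Fin.sum_univ_two] using hr'.symm)
  exact ⟨by simpa using key 0 (by simpa using hs), by simpa using key 1 (by simpa using ht)⟩

theorem IsExtremalRayAt.image (h : IsExtremalRayAt C x ρ) (φ : E ≃ₗ[ℝ] E) (hφ : φ '' C = C) :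
    IsExtremalRayAt C (φ x) (φ '' ρ) := by
  obtain ⟨y, hy, rfl, hC, h⟩ := h
  refine ⟨φ y, by simpa using hy, image_ray φ x y, ?_, ?_⟩
  · rw [← hφ]
    exact Set.image_mono hC
  · intro r n d z hr hd hd1 hz hsum k hk
    have hz' (k : Fin n) : φ.symm (z k) ∈ C := by
      have := hz k
      rw [← hφ] at this
      obtain ⟨c, hc, hck⟩ := this
      rw [← hck, LinearEquiv.symm_apply_apply]
      exact hc
    refine ⟨φ.symm (z k), h r n d (fun k => φ.symm (z k)) hr hd hd1 hz' ?_ k hk, by simp⟩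
    have := congrArg φ.symm hsum
    simpa using this

end Rays

/-! ### The set `P(λ, J)` and its extremal rays -/

namespace Realization

variable {ι : Type u} [Fintype ι] {A : GenCartanMatrix ι} {𝔥 : Type v}
  [AddCommGroup 𝔥] [Module ℂ 𝔥] (R : Realization A 𝔥) {lam : Module.Dual ℂ 𝔥} {J : Set ι}

/-- The orbit `W_J lam`. -/
def weylOrbit (lam : Module.Dual ℂ 𝔥) (J : Set ι) : Set (Module.Dual ℂ 𝔥) :=
  {μ | ∃ w ∈ R.parabolic J, w lam = μ}

theorem mem_shape {x : Module.Dual ℂ 𝔥} : x ∈ R.shape lam J ↔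
    ∃ o ∈ convexHull ℝ (R.weylOrbit lam J), ∃ κ ∈ PointedCone.hull ℝ (R.nilOrbit J),
      o - κ = x := by
  rw [shape, hull_posRoots_diff]
  exact Set.mem_sub

theorem orbit_sub_mem_shape {w : Module.Dual ℂ 𝔥 ≃ₗ[ℂ] Module.Dual ℂ 𝔥}
    (hw : w ∈ R.parabolic J) {κ : Module.Dual ℂ 𝔥}
    (hκ : κ ∈ PointedCone.hull ℝ (R.nilOrbit J)) : w lam - κ ∈ R.shape lam J :=
  R.mem_shape.2 ⟨_, subset_convexHull ℝ _ ⟨w, hw, rfl⟩, κ, hκ, rfl⟩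

theorem orbit_mem_shape {w : Module.Dual ℂ 𝔥 ≃ₗ[ℂ] Module.Dual ℂ 𝔥}
    (hw : w ∈ R.parabolic J) : w lam ∈ R.shape lam J := by
  simpa using R.orbit_sub_mem_shape (lam := lam) hw (zero_mem _)

theorem convex_shape : Convex ℝ (R.shape lam J) :=
  (convex_convexHull ℝ _).sub (PointedCone.convex _)

theorem parabolic_mem_shape {w : Module.Dual ℂ 𝔥 ≃ₗ[ℂ] Module.Dual ℂ 𝔥}
    (hw : w ∈ R.parabolic J) {x : Module.Dual ℂ 𝔥} (hx : x ∈ R.shape lam J) :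
    w x ∈ R.shape lam J := by
  obtain ⟨o, ho, κ, hκ, rfl⟩ := R.mem_shape.1 hx
  refine R.mem_shape.2 ⟨w o, ?_, w κ, R.parabolic_mem_hull hw hκ, (map_sub w o κ).symm⟩
  have hconv : Convex ℝ (w.restrictScalars ℝ ⁻¹' convexHull ℝ (R.weylOrbit lam J)) :=
    (convex_convexHull ℝ _).linear_preimage (w.restrictScalars ℝ).toLinearMap
  refine convexHull_min ?_ hconv ho
  rintro _ ⟨v, hv, rfl⟩
  exact subset_convexHull ℝ _ ⟨w * v, mul_mem hw hv, rfl⟩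

theorem image_shape {w : Module.Dual ℂ 𝔥 ≃ₗ[ℂ] Module.Dual ℂ 𝔥}
    (hw : w ∈ R.parabolic J) : w '' R.shape lam J = R.shape lam J := by
  refine Set.Subset.antisymm ?_ fun x hx => ?_
  · rintro _ ⟨x, hx, rfl⟩
    exact R.parabolic_mem_shape hw hx
  · exact ⟨w⁻¹ x, R.parabolic_mem_shape (inv_mem hw) hx, LinearEquiv.apply_symm_apply w x⟩

theorem sub_mem_rootCone_of_mem_shape (hJ : J ⊆ R.realDominant lam) {x : Module.Dual ℂ 𝔥}
    (hx : x ∈ R.shape lam J) : lam - x ∈ R.rootCone := by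
  obtain ⟨o, ho, κ, hκ, rfl⟩ := R.mem_shape.1 hx
  have hconv : Convex ℝ {o : Module.Dual ℂ 𝔥 | lam - o ∈ R.rootCone} := by
    intro a ha b hb s t hs ht hst
    have : lam - (s • a + t • b) = s • (lam - a) + t • (lam - b) := by
      nth_rw 1 [← one_smul ℝ lam, ← hst]
      module
    rw [Set.mem_ofPred_eq, this]
    exact add_mem (PointedCone.smul_mem _ hs ha) (PointedCone.smul_mem _ ht hb)
  have ho' : lam - o ∈ R.rootCone := by
    refine convexHull_min ?_ hconv ho
    rintro _ ⟨w, hw, rfl⟩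
    exact R.sub_mem_rootCone hJ hw
  rw [← sub_add]
  exact add_mem ho' (R.hull_nilOrbit_le J hκ)

/-- Orbit points are vertices: after translation by `w⁻¹`, both deviations from `lam` lie in a
salient cone and sum to zero. -/
theorem orbit_eq_of_add_eq (hJ : J ⊆ R.realDominant lam)
    {w : Module.Dual ℂ 𝔥 ≃ₗ[ℂ] Module.Dual ℂ 𝔥} (hw : w ∈ R.parabolic J)
    {x z : Module.Dual ℂ 𝔥} (hx : x ∈ R.shape lam J) (hz : z ∈ R.shape lam J)
    (h : x + z = w lam + w lam) : x = w lam := by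
  have hx' := R.sub_mem_rootCone_of_mem_shape hJ (R.parabolic_mem_shape (inv_mem hw) hx)
  have hz' := R.sub_mem_rootCone_of_mem_shape hJ (R.parabolic_mem_shape (inv_mem hw) hz)
  have hinv (y : Module.Dual ℂ 𝔥) : w⁻¹ (w y) = y := LinearEquiv.symm_apply_apply w y
  have hinv' (y : Module.Dual ℂ 𝔥) : w (w⁻¹ y) = y := LinearEquiv.apply_symm_apply w y
  have := R.eq_zero_of_add_eq_zero hx' hz' (by
    have := congrArg (w⁻¹ : Module.Dual ℂ 𝔥 ≃ₗ[ℂ] Module.Dual ℂ 𝔥) h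
    rw [map_add, map_add, hinv] at this
    rw [sub_add_sub_comm, this, sub_self])
  rw [sub_eq_zero] at this
  rw [this, hinv']

theorem isExtremalRayAt_image {w : Module.Dual ℂ 𝔥 ≃ₗ[ℂ] Module.Dual ℂ 𝔥}
    (hw : w ∈ R.parabolic J) {x : Module.Dual ℂ 𝔥} {ρ : Set (Module.Dual ℂ 𝔥)}
    (h : IsExtremalRayAt (R.shape lam J) x ρ) :
    IsExtremalRayAt (R.shape lam J) (w x) (w '' ρ) :=
  h.image (w.restrictScalars ℝ) (R.image_shape hw)

omit [Fintype ι] in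
theorem image_ray' (w : Module.Dual ℂ 𝔥 ≃ₗ[ℂ] Module.Dual ℂ 𝔥) (x y : Module.Dual ℂ 𝔥) :
    w '' ray x y = ray (w x) (w y) :=
  image_ray (w.restrictScalars ℝ) x y

/-- The rays `lam - ℝ_{≥ 0} α_i`, `i ∉ J`, are extremal. -/
theorem isExtremalRayAt_root (hJ : J ⊆ R.realDominant lam) {i : ι} (hi : i ∉ J) :
    IsExtremalRayAt (R.shape lam J) lam (ray lam (-R.root i)) := by
  refine ⟨-R.root i, neg_ne_zero.2 (R.root_indep.ne_zero i), rfl, ?_, ?_⟩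
  · rintro _ ⟨r, hr, rfl⟩
    rw [smul_neg, ← sub_eq_add_neg]
    exact R.orbit_sub_mem_shape (one_mem _)
      (PointedCone.smul_mem _ hr (Submodule.subset_span ⟨1, one_mem _, i, hi, rfl⟩))
  · intro r n d z hr hd hd1 hz hsum k hk
    have hz' (k : Fin n) := R.mem_rootCone.1 (R.sub_mem_rootCone_of_mem_shape hJ (hz k))
    choose c hc0 hc using hz'
    -- The coefficients at `l ≠ i` are nonnegative with weighted sum zero, so those of positive
    -- weight vanish.
    have hzero (l : ι) (hl : l ≠ i) : c k l = 0 := by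
      have h₁ : r • R.root i = ∑ k, d k • (lam - z k) := by
        simp only [smul_sub, Finset.sum_sub_distrib]
        rw [← Finset.sum_smul, hd1, ← hsum]
        module
      have h₂ := congrArg (fun x => R.coeff x l) h₁
      simp only [hc] at h₂
      rw [coeff_real_smul, coeff_root, Finsupp.single_eq_of_ne hl, mul_zero, map_sum,
        Finsupp.finsetSum_apply] at h₂
      simp only [coeff_real_smul, coeff_sum_smul] at h₂
      have h₃ : ∑ k, d k * c k l = 0 := by exact_mod_cast h₂.symm
      have h₄ := (Finset.sum_eq_zero_iff_of_nonneg fun k _ => mul_nonneg (hd k) (hc0 k l)).1 h₃ k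
        (Finset.mem_univ k)
      exact (mul_eq_zero.1 h₄).resolve_left hk.ne'
    refine ⟨c k i, hc0 k i, ?_⟩
    have : lam - z k = c k i • R.root i := by
      rw [hc k]
      exact Finset.sum_eq_single i (fun l _ hl => by rw [hzero l hl, zero_smul]) (by simp)
    rw [smul_neg, ← this]
    abel

/-- A point `x + y` of an extremal ray with `y ≠ 0` can be replaced by a point over the orbit. -/
theorem exists_orbit_sub_mem {x : Module.Dual ℂ 𝔥} {ρ : Set (Module.Dual ℂ 𝔥)}
    (h : IsExtremalRayAt (R.shape lam J) x ρ) :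
    ∃ w ∈ R.parabolic J, ∃ κ ∈ PointedCone.hull ℝ (R.nilOrbit J),
      w lam - κ ∈ ρ ∧ w lam - κ ≠ x := by
  obtain ⟨y, hy, hρ, hC, -⟩ := id h
  have hxy : x + y ∈ ρ := by rw [hρ]; exact ⟨1, zero_le_one, by simp⟩
  obtain ⟨o, ho, κ, hκ, hoκ⟩ := R.mem_shape.1 (hC hxy)
  by_contra! hcon
  -- Extremality makes this set convex. If the claim failed, it would contain the orbit, hence its
  -- convex hull, hence `o`, giving `x + y = x`.
  have hconv : Convex ℝ {o | o - κ ∈ R.shape lam J ∧ (o - κ ∈ ρ → o - κ = x)} := by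
    rw [convex_iff_forall_pos]
    rintro a ⟨ha, ha'⟩ b ⟨hb, hb'⟩ s t hs ht hst
    have hsum : s • a + t • b - κ = s • (a - κ) + t • (b - κ) := by
      nth_rw 1 [← one_smul ℝ κ, ← hst]
      module
    rw [Set.mem_ofPred_eq, hsum]
    refine ⟨R.convex_shape ha hb hs.le ht.le hst, fun hmem => ?_⟩
    obtain ⟨h₁, h₂⟩ := h.mem_of_combination ha hb hs ht hst hmem
    rw [ha' h₁, hb' h₂, ← add_smul, hst, one_smul]
  have hsub : R.weylOrbit lam J ⊆ {o | o - κ ∈ R.shape lam J ∧ (o - κ ∈ ρ → o - κ = x)} := by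
    rintro _ ⟨w, hw, rfl⟩
    exact ⟨R.orbit_sub_mem_shape hw hκ, hcon w hw κ hκ⟩
  have := (convexHull_min hsub hconv ho).2 (hoκ ▸ hxy)
  rw [hoκ] at this
  exact hy (by simpa using this)

/-- Points of the orbit `W_J lam` are not interior points of rays in the shape. -/
theorem orbit_eq_of_mem_ray (hJ : J ⊆ R.realDominant lam)
    {w : Module.Dual ℂ 𝔥 ≃ₗ[ℂ] Module.Dual ℂ 𝔥} (hw : w ∈ R.parabolic J)
    {x y : Module.Dual ℂ 𝔥} (hρ : ray x y ⊆ R.shape lam J) (h : w lam ∈ ray x y) :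
    x = w lam := by
  obtain ⟨r, hr, hr'⟩ := h
  -- The point `w lam = x + r y` is the midpoint of `x` and `x + 2r y`.
  refine R.orbit_eq_of_add_eq hJ hw (hρ (mem_ray_self x y)) (z := x + (2 * r) • y)
    (hρ ⟨2 * r, by positivity, rfl⟩) ?_
  rw [hr']
  module

theorem orbit_mem_of_orbit_sub_mem {x κ : Module.Dual ℂ 𝔥} {ρ : Set (Module.Dual ℂ 𝔥)}
    (h : IsExtremalRayAt (R.shape lam J) x ρ) {w : Module.Dual ℂ 𝔥 ≃ₗ[ℂ] Module.Dual ℂ 𝔥}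
    (hw : w ∈ R.parabolic J) (hκ : κ ∈ PointedCone.hull ℝ (R.nilOrbit J))
    (hmem : w lam - κ ∈ ρ) : w lam ∈ ρ := by
  -- The given point is the midpoint of `w lam` and `w lam - 2κ`.
  refine (h.mem_of_combination (R.orbit_mem_shape hw) (R.orbit_sub_mem_shape (κ := (2 : ℝ) • κ) hw
    (PointedCone.smul_mem _ zero_le_two hκ)) (s := 1 / 2) (t := 1 / 2) (by norm_num) (by norm_num)
    (by norm_num) ?_).1
  convert hmem using 1
  module

/-- An extremal ray starts at a point of the orbit, and its direction lies in `-W_J Π_{J^c}`. -/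
theorem exists_eq_ray_of_isExtremalRayAt (hJ : J ⊆ R.realDominant lam) {x : Module.Dual ℂ 𝔥}
    {ρ : Set (Module.Dual ℂ 𝔥)} (h : IsExtremalRayAt (R.shape lam J) x ρ) :
    ∃ w ∈ R.parabolic J, x = w lam ∧ ∃ β ∈ R.nilOrbit J, ρ = ray x (-β) := by
  obtain ⟨w, hw, κ, hκ, hmem, hne⟩ := R.exists_orbit_sub_mem h
  obtain ⟨y, hy, hρ, hC, -⟩ := id h
  have hx : x = w lam := R.orbit_eq_of_mem_ray hJ hw (hρ ▸ hC)
    (hρ ▸ R.orbit_mem_of_orbit_sub_mem h hw hκ hmem)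
  refine ⟨w, hw, hx, ?_⟩
  rcases R.eq_zero_or_exists_add_smul hκ with rfl | ⟨β, hβ, c, hc, κ', hκ', rfl⟩
  · exact absurd (by rw [sub_zero, hx]) hne
  refine ⟨β, hβ, ?_⟩
  have hβ0 : β ≠ 0 := (R.mem_posRoots_diff.1 (R.nilOrbit_subset J hβ)).1.1
  have hpt (M : ℝ) (hM : 0 ≤ M) : w lam - κ' - M • β ∈ R.shape lam J := by
    rw [sub_sub]
    exact R.orbit_sub_mem_shape hw (add_mem hκ' (PointedCone.smul_mem _ hM
      (Submodule.subset_span hβ)))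
  -- The point `w lam - κ' - cβ` is interior to the segment between these two, so both lie on the
  -- ray. This makes `β` parallel to `y`.
  have hM (M : ℝ) (hM : c < M) : w lam - κ' ∈ ρ ∧ w lam - κ' - M • β ∈ ρ := by
    have hM0 : 0 < M := hc.trans hM
    have h0 := hpt 0 le_rfl
    rw [zero_smul, sub_zero] at h0
    refine h.mem_of_combination h0 (hpt M hM0.le) (s := 1 - c / M) (t := c / M) ?_ (by positivity)
      (by ring) ?_
    · rw [sub_pos, div_lt_one hM0]
      exact hM
    · have : (1 - c / M) • (w lam - κ') + (c / M) • (w lam - κ' - M • β) =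
          w lam - (κ' + c • β) := by
        rw [smul_sub (c / M) (w lam - κ'), smul_smul, div_mul_cancel₀ _ hM0.ne']
        module
      rw [this]
      exact hmem
  rw [hρ] at hM
  obtain ⟨r₀, hr₀, h₀⟩ := (hM (c + 1) (by linarith)).1
  obtain ⟨r₁, hr₁, h₁⟩ := (hM (c + 1) (by linarith)).2
  have hy' : (c + 1) • β = (r₀ - r₁) • y := by
    rw [h₀] at h₁
    rw [← sub_eq_zero] at h₁ ⊢
    rw [← neg_eq_zero, ← h₁]
    module
  have hc1 : 0 < c + 1 := by linarith
  have hs : r₀ - r₁ ≠ 0 := fun h0 => by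
    rw [h0, zero_smul, smul_eq_zero] at hy'
    exact hy'.elim hc1.ne' hβ0
  set s := (r₀ - r₁) / (c + 1) with hsdef
  have hβs : β = s • y := by
    rw [hsdef, div_eq_inv_mul, mul_smul, ← hy', smul_smul, inv_mul_cancel₀ hc1.ne', one_smul]
  have hs0 : s < 0 := by
    by_contra! hcon
    have hspos : 0 < s := lt_of_le_of_ne hcon (Ne.symm (div_ne_zero hs hc1.ne'))
    -- If `β` were a positive multiple of `y`, going far along `-β` would leave the ray: this `M`
    -- gives parameter `r₀ - M s = -(c + 1) s < 0`.
    set M := c + 1 + r₀ / s with hMdef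
    have hcM : c < M := by
      have : 0 ≤ r₀ / s := by positivity
      linarith
    obtain ⟨r₂, hr₂, h₂⟩ := (hM M hcM).2
    rw [h₀, hβs] at h₂
    have h₃ : (r₀ - M * s - r₂) • y = 0 := by
      rw [← sub_eq_zero] at h₂
      rw [← h₂]
      module
    have h₄ := (smul_eq_zero.1 h₃).resolve_right hy
    have h₅ : M * s = (c + 1) * s + r₀ := by
      rw [hMdef, add_mul, div_mul_cancel₀ _ hspos.ne']
    have : 0 < (c + 1) * s := by positivity
    linarith
  rw [hρ, hβs, ← neg_smul, ray_smul (by linarith)]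

/-- The directions of the extremal rays at `lam`. -/
theorem exists_eq_of_isExtremalRayAt {β : Module.Dual ℂ 𝔥} (hJ : J ⊆ R.realDominant lam)
    {i : ι} (hi : i ∉ J) (hβ : ∃ w ∈ R.parabolic J, β = w (R.root i))
    (h : IsExtremalRayAt (R.shape lam J) lam (ray lam (-β))) :
    ∃ u ∈ R.parabolic (R.fixing lam J), β = u (R.root i) := by
  have hβS : β ∈ R.posRoots \ R.subPosRoots J := by
    obtain ⟨w, hw, rfl⟩ := hβ
    exact R.nilOrbit_subset J ⟨w, hw, i, hi, rfl⟩
  refine R.posRoots_diff_induction (p := fun β => (∃ w ∈ R.parabolic J, β = w (R.root i)) →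
    IsExtremalRayAt (R.shape lam J) lam (ray lam (-β)) →
    ∃ u ∈ R.parabolic (R.fixing lam J), β = u (R.root i)) ?_ hβS hβ h
  clear hβS hβ h
  intro β hβS ih hβ h
  obtain ⟨w, hw, hwβ⟩ := hβ
  have hrefl (j : ι) (hj : j ∈ J) : R.simpleReflection j β =
      (R.simpleReflection j * w) (R.root i) := by rw [hwβ]; rfl
  by_cases hex : ∃ j ∈ J, ∃ m : ℤ, 0 < m ∧ β (R.coroot j) = m
  · obtain ⟨j, hj, m, hm, hβj⟩ := hex
    by_cases hfix : R.simpleReflection j lam = lam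
    · have hjfix : j ∈ R.fixing lam J := ⟨hj, hfix⟩
      obtain ⟨u, hu, hu'⟩ := ih _ (R.reflection_mem_posRoots_diff hj hβS) m.toNat (by omega)
        (R.height_reflection hβj hm) ⟨_, mul_mem (R.simpleReflection_mem hj) hw, hrefl j hj⟩ (by
          have := R.isExtremalRayAt_image (R.simpleReflection_mem hj) h
          rwa [image_ray', hfix, map_neg] at this)
      refine ⟨_, mul_mem (R.simpleReflection_mem hjfix) hu, ?_⟩
      rw [LinearEquiv.mul_apply, ← hu', reflection_reflection]
    · exfalso
      obtain ⟨a, ha, haj⟩ := hJ hj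
      have ha0 : 0 < a := by
        refine lt_of_le_of_ne ha fun h0 => hfix ?_
        rw [simpleReflection_apply, haj, ← h0]
        simp
      have hm' : (0 : ℝ) < m := by exact_mod_cast hm
      -- With this `r`, `lam - rβ` is the midpoint of `lam - r s_j β` and `s_j lam - r s_j β`, both
      -- in the shape. Extremality puts the first on the ray, and its coefficient at `i` forces `s_j
      -- β = β`, contradicting `m > 0`.
      set r : ℝ := a / (2 * m) with hr
      have hr0 : 0 < r := by positivity
      have hsβ : R.simpleReflection j β = β - (m : ℝ) • R.root j := by
        rw [simpleReflection_apply, hβj, ← Complex.coe_smul]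
        push_cast
        rfl
      have hslam : R.simpleReflection j lam = lam - a • R.root j := by
        rw [simpleReflection_apply, haj, Complex.coe_smul]
      have hκ : r • R.simpleReflection j β ∈ PointedCone.hull ℝ (R.nilOrbit J) :=
        PointedCone.smul_mem _ hr0.le (Submodule.subset_span
          ⟨_, mul_mem (R.simpleReflection_mem hj) hw, i, hi, hrefl j hj⟩)
      have hmem := (h.mem_of_combination (R.orbit_sub_mem_shape (one_mem _) hκ)
        (R.orbit_sub_mem_shape (R.simpleReflection_mem hj) hκ) (s := 1 / 2) (t := 1 / 2)
        (by norm_num) (by norm_num) (by norm_num) ⟨r, hr0.le, by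
          rw [LinearEquiv.coe_one, id_eq, hslam, hsβ]
          have hrm : a = 2 * (r * m) := by rw [hr]; field_simp
          rw [hrm]
          module⟩).1
      obtain ⟨r', hr', heq⟩ := hmem
      rw [LinearEquiv.coe_one, id_eq, smul_neg, ← sub_eq_add_neg, sub_right_inj] at heq
      have hcoeff := congrArg (fun x => R.coeff x i) heq
      have hji : j ≠ i := fun h => hi (h ▸ hj)
      simp only [coeff_real_smul] at hcoeff
      rw [R.coeff_reflection_of_ne hji, hwβ, R.coeff_parabolic hw hi, coeff_root] at hcoeff
      have hrr : r = r' := by simpa using hcoeff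
      rw [← hrr] at heq
      have := smul_right_injective _ hr0.ne' heq
      rw [hsβ, sub_eq_self, smul_eq_zero] at this
      exact this.elim hm'.ne' (R.root_indep.ne_zero j)
  · push Not at hex
    refine ⟨1, one_mem _, ?_⟩
    -- Both `-β` and `-α_i` are `J`-dominant and lie in one `W_J`-orbit, so each is below the other
    -- and they coincide.
    have hdom : J ⊆ R.realDominant (-β) := by
      intro j hj
      obtain ⟨m, hm⟩ := R.exists_intCast_eq hβS.1.2 j
      have hm0 : m ≤ 0 := by
        by_contra! hcon
        exact hex j hj m hcon hm
      refine ⟨-m, ?_, by simp [hm]⟩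
      have : (m : ℝ) ≤ 0 := by exact_mod_cast hm0
      linarith
    have hdom' : J ⊆ R.realDominant (-R.root i) := by
      intro j hj
      have hji : j ≠ i := fun h => hi (h ▸ hj)
      refine ⟨-(A.a j i : ℤ), ?_, by simp [R.pairing]⟩
      have : (A.a j i : ℝ) ≤ 0 := by exact_mod_cast A.off_diag j i hji
      linarith
    have h₁ := R.sub_mem_rootCone hdom (inv_mem hw)
    have h₂ := R.sub_mem_rootCone hdom' hw
    have hinv : w⁻¹ β = R.root i := by rw [hwβ]; exact LinearEquiv.symm_apply_apply w _
    rw [map_neg, hinv] at h₁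
    rw [map_neg, ← hwβ] at h₂
    have := R.eq_zero_of_add_eq_zero h₁ h₂ (by abel)
    rw [sub_neg_eq_add, neg_add_eq_zero] at this
    exact this

theorem parabolic_fixing_apply {u : Module.Dual ℂ 𝔥 ≃ₗ[ℂ] Module.Dual ℂ 𝔥}
    (hu : u ∈ R.parabolic (R.fixing lam J)) : u lam = lam := by
  refine R.parabolic_induction (p := fun u => u lam = lam) rfl (fun j hj u ih => ?_) hu
  rw [LinearEquiv.mul_apply, ih, hj.2]

theorem fixing_subset : R.fixing lam J ⊆ J := fun _ h => h.1

/-- Coefficients outside `J` are `W_J`-invariant: at `i`, directions from the orbit of `i` have a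
nonzero coefficient, those from the orbit of `k ≠ i` have zero. -/
theorem pairwiseDisjoint_orbitOfSet :
    Jᶜ.PairwiseDisjoint fun i => orbitOfSet (R.parabolic J) (ray lam (-R.root i)) := by
  intro i hi k _ hik
  rw [Function.onFun, Set.disjoint_left]
  rintro σ ⟨w, hw, rfl⟩ ⟨v, hv, h⟩
  rw [image_ray', image_ray'] at h
  have h₀ : w lam ∈ ray (v lam) (v (-R.root k)) := h ▸ mem_ray_self _ _
  have h₁ : w lam + w (-R.root i) ∈ ray (v lam) (v (-R.root k)) := by
    rw [← h]
    exact ⟨1, zero_le_one, by simp⟩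
  obtain ⟨r, -, hr⟩ := h₀
  obtain ⟨s, -, hs⟩ := h₁
  have heq : w (-R.root i) = (s - r) • v (-R.root k) := by
    rw [hr, add_assoc, add_right_inj] at hs
    rw [sub_smul, ← hs, add_sub_cancel_left]
  have := congrArg (fun x => R.coeff x i) heq
  simp only [coeff_real_smul] at this
  rw [R.coeff_parabolic hw hi, R.coeff_parabolic hv hi, map_neg, map_neg, Finsupp.neg_apply,
    Finsupp.neg_apply, coeff_root, coeff_root, Finsupp.single_eq_same,
    Finsupp.single_eq_of_ne hik] at this
  simp at this

theorem extremalRaysAt_shape (hJ : J ⊆ R.realDominant lam) :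
    extremalRaysAt (R.shape lam J) lam =
      ⋃ i ∈ Jᶜ, orbitOfSet (R.parabolic (R.fixing lam J)) (ray lam (-R.root i)) := by
  ext ρ
  simp only [Set.mem_iUnion, exists_prop]
  constructor
  · intro h
    obtain ⟨w, hw, hx, β, ⟨v, hv, i, hi, hβ⟩, rfl⟩ := R.exists_eq_ray_of_isExtremalRayAt hJ h
    obtain ⟨u, hu, rfl⟩ := R.exists_eq_of_isExtremalRayAt hJ hi ⟨v, hv, hβ⟩ h
    exact ⟨i, hi, u, hu, by rw [image_ray', R.parabolic_fixing_apply hu, map_neg]⟩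
  · rintro ⟨i, hi, u, hu, rfl⟩
    have := R.isExtremalRayAt_image (R.parabolic_mono R.fixing_subset hu)
      (R.isExtremalRayAt_root hJ hi)
    rwa [R.parabolic_fixing_apply hu] at this

/-- Every extremal ray starts at some `w lam`; applying `w⁻¹` reduces to rays at `lam`. -/
theorem extremalRays_shape (hJ : J ⊆ R.realDominant lam) :
    extremalRays (R.shape lam J) =
      ⋃ i ∈ Jᶜ, orbitOfSet (R.parabolic J) (ray lam (-R.root i)) := by
  ext ρ
  simp only [Set.mem_iUnion, exists_prop]
  constructor
  · rintro ⟨x, -, h⟩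
    obtain ⟨w, hw, rfl, -⟩ := R.exists_eq_ray_of_isExtremalRayAt hJ h
    have h' := R.isExtremalRayAt_image (inv_mem hw) h
    rw [show w⁻¹ (w lam) = lam from LinearEquiv.symm_apply_apply w lam] at h'
    have h'' : ⇑w⁻¹ '' ρ ∈ extremalRaysAt (R.shape lam J) lam := h'
    rw [R.extremalRaysAt_shape hJ] at h''
    simp only [Set.mem_iUnion, exists_prop] at h''
    obtain ⟨i, hi, u, hu, hρ⟩ := h''
    refine ⟨i, hi, w * u, mul_mem hw (R.parabolic_mono R.fixing_subset hu), ?_⟩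
    have : ρ = w '' (⇑w⁻¹ '' ρ) := by
      rw [← Set.image_comp]
      convert (Set.image_id ρ).symm using 2
      exact LinearEquiv.apply_symm_apply w _
    rw [this, hρ, ← Set.image_comp]
    rfl
  · rintro ⟨i, hi, w, hw, rfl⟩
    exact ⟨_, R.orbit_mem_shape hw, R.isExtremalRayAt_image hw (R.isExtremalRayAt_root hJ hi)⟩

end Realization

end KacMoody

theorem proposition2p11 {ι : Type*} [Fintype ι]
    {𝔥 : Type*} [AddCommGroup 𝔥] [Module ℂ 𝔥]
    (A : KacMoody.GenCartanMatrix ι) (R : KacMoody.Realization A 𝔥)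
    (lam : Module.Dual ℂ 𝔥) (J : Set ι) (hJ : J ⊆ R.realDominant lam) :
    (∀ w ∈ R.parabolic J, w '' R.shape lam J = R.shape lam J) ∧
    Convex ℝ (R.shape lam J) ∧
    R.shape lam J ⊆ {lam} - (PointedCone.hull ℝ (Set.range R.root) : Set (Module.Dual ℂ 𝔥)) ∧
    KacMoody.extremalRays (R.shape lam J) =
      ⋃ i ∈ Jᶜ, KacMoody.orbitOfSet (R.parabolic J) (KacMoody.ray lam (-R.root i)) ∧
    Jᶜ.PairwiseDisjoint
      (fun i => KacMoody.orbitOfSet (R.parabolic J) (KacMoody.ray lam (-R.root i))) ∧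
    KacMoody.extremalRaysAt (R.shape lam J) lam =
      ⋃ i ∈ Jᶜ, KacMoody.orbitOfSet (R.parabolic (R.fixing lam J))
        (KacMoody.ray lam (-R.root i)) ∧
    Jᶜ.PairwiseDisjoint
      (fun i => KacMoody.orbitOfSet (R.parabolic (R.fixing lam J))
        (KacMoody.ray lam (-R.root i))) := by
  refine ⟨fun w hw => R.image_shape hw, R.convex_shape, fun x hx => ?_, R.extremalRays_shape hJ,
    R.pairwiseDisjoint_orbitOfSet, R.extremalRaysAt_shape hJ, ?_⟩
  · exact Set.mem_sub.2 ⟨lam, rfl, lam - x, R.sub_mem_rootCone_of_mem_shape hJ hx,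
      sub_sub_self lam x⟩
  · refine (R.pairwiseDisjoint_orbitOfSet (lam := lam) (J := J)).mono fun i => ?_
    rintro σ ⟨w, hw, rfl⟩
    exact ⟨w, R.parabolic_mono R.fixing_subset hw, rfl⟩
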